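/- **Setting.** Let $M\in GL(2,\mathbb Z)$ have an eigenvalue $\lambda$ with $|\lambda|>1$ (such an $M$ is automatically primitive, i.e. some power has no zero entry), let $V,W\subset\mathbb R^2$ be its expanding and contracting eigenlines, and let $Y=\{0\}\times\mathbb R\cong\mathbb R$ be the vertical axis. Let $\Pi_V$ be the projection onto $V$ parallel to $W$, and $\Pi_Y$ the projection onto $Y$ parallel to $V$. For a half-open interval $\Omega\subset Y$ of length $|\Omega|>0$ (closed on either side), $\Pi_V(\mathbb Z^2\cap(V+\Omega))$ is the vertex set of a tiling of the line $V$ by intervals, the tiling with interval projection structure given by $V,W,\Omega$. A *substitution rule* on a finite set of labelled prototiles (intervals of given lengths) with inflation factor $c>1$ assigns to each prototile a patch of prototiles that exactly covers the prototile inflated by $c$. A tiling *admits* the rule if its tiles can be labelled, respecting lengths, such that for every $k\in\mathbb N$ the labelled tiling is the image under the $k$-th iterate of the rule of a labelled tiling that is locally isomorphic to it (the two have the same finite labelled patches up to translation). The rule (with this labelling) is *local* if there is an $r$ such that the lengths of the tiles at most $r$ places away from a tile determine the label of that tile, and *nonlocal* otherwise. **Statement.** (1) If $$|\Omega|\notin\frac{\Pi_Y(\mathbb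 Z^2)}{\det M+\lambda}\cup\frac{\Pi_Y(\mathbb Z^2)}{\det M-\lambda},$$ then every substitution rule with inflation factor $|\lambda|$ that the tiling admits (with any finite set of prototiles and any labelling) is nonlocal. If the upper right entry of $M$ is $\pm1$, then $\Pi_Y(\mathbb Z^2)=\mathbb Z[\lambda]$, so that the condition reads $|\Omega|\notin \mathbb Z[\lambda]/(\det M+\lambda)\cup\mathbb Z[\lambda]/(\det M-\lambda)$. (2) Let $M=\begin{pmatrix}1&1\\1&0\end{pmatrix}$, so that $\det M=-1$ and $\lambda=\tau=(1+\sqrt5)/2$, let $n>1$ be an integer and $|\Omega|=1/n$. Then $1/n\notin \mathbb Z[\tau]/(\det M+\tau)\cup\mathbb Z[\tau]/(\det M-\tau)$, and the tiling admits a substitution rule with inflation factor $\tau$, but every such rule is nonlocal. -/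

import Mathlib

/-! ### The projections attached to two lines in the plane -/

/-- The vector `z ∈ ℤ²` viewed in `ℝ²`. -/
def latticeVec (z : Fin 2 → ℤ) : Fin 2 → ℝ := fun i => (z i : ℝ)

/-- `Π_V`: the projection onto `V = ℝ v` parallel to `W = ℝ w`, where `V` is identified with `ℝ`
through `x ↦ x • v` (see `sub_projV_smul`). -/
noncomputable def projV (v w p : Fin 2 → ℝ) : ℝ :=
  (p 0 * w 1 - p 1 * w 0) / (v 0 * w 1 - v 1 * w 0)

/-- `Π_Y`: the projection onto the vertical axis `Y` parallel to `V = ℝ v`, where `Y` is identified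
with `ℝ` through `y ↦ (0, y)` (see `sub_projY`). -/
noncomputable def projY (v p : Fin 2 → ℝ) : ℝ := p 1 - p 0 * (v 1 / v 0)

theorem sub_projV_smul (v w p : Fin 2 → ℝ) (h : v 0 * w 1 - v 1 * w 0 ≠ 0) :
    ∃ c : ℝ, p - projV v w p • v = c • w := by
  refine ⟨(v 0 * p 1 - v 1 * p 0) / (v 0 * w 1 - v 1 * w 0), ?_⟩
  ext i
  fin_cases i <;> simp only [projV, Pi.sub_apply, Pi.smul_apply, smul_eq_mul] <;>
    rw [div_mul_eq_mul_div, div_mul_eq_mul_div, sub_eq_iff_eq_add, ← add_div, eq_div_iff h] <;>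
    simp <;> ring

theorem sub_projY (v p : Fin 2 → ℝ) (h : v 0 ≠ 0) :
    ∃ c : ℝ, p - ![0, projY v p] = c • v := by
  refine ⟨p 0 / v 0, ?_⟩
  ext i
  fin_cases i <;> simp [projY] <;> field_simp

/-- `Π_Y(ℤ²)`. -/
def latticeProj (v : Fin 2 → ℝ) : Set ℝ := Set.range fun z : Fin 2 → ℤ => projY v (latticeVec z)

/-- `R / c = {y / c | y ∈ R}`. -/
def quotSet (R : Set ℝ) (c : ℝ) : Set ℝ := {x | ∃ y ∈ R, x = y / c}

/-- `Ω` is a half-open interval of length `L > 0`. -/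
def IsWindow (Ω : Set ℝ) (L : ℝ) : Prop :=
  0 < L ∧ ∃ t : ℝ, Ω = Set.Ico t (t + L) ∨ Ω = Set.Ioc t (t + L)

/-- The vertex set `Π_V(ℤ² ∩ (V + Ω))` of the tiling with interval projection structure. A lattice
point lies in `V + Ω` exactly when its projection to `Y` parallel to `V` lies in `Ω`. -/
def projectionTiling (v w : Fin 2 → ℝ) (Ω : Set ℝ) : Set ℝ :=
  {x | ∃ z : Fin 2 → ℤ, projY v (latticeVec z) ∈ Ω ∧ x = projV v w (latticeVec z)}

/-- `M ∈ GL(2, ℤ)`, and `ℝ v`, `ℝ w` are its expanding and contracting eigenspaces, with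
eigenvalues `lam` and `mu`. -/
structure IsEigenFrame (M : Matrix (Fin 2) (Fin 2) ℤ) (lam mu : ℝ) (v w : Fin 2 → ℝ) : Prop where
  unimodular : IsUnit M.det
  expanding : 1 < |lam|
  contracting : |mu| < 1
  v_ne : v ≠ 0
  w_ne : w ≠ 0
  map_v : (M.map (Int.cast : ℤ → ℝ)).mulVec v = lam • v
  map_w : (M.map (Int.cast : ℤ → ℝ)).mulVec w = mu • w

/-! ### Labelled tilings of the line and geometric substitution rules -/

/-- A set of prototiles indexed by the labels `A`: a prototile is an interval of a given length
together with its label. -/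
structure Protoset (A : Type) where
  len : A → ℝ
  len_pos : ∀ a, 0 < len a

/-- A tiling of the line by translates of prototiles: the tile number `i` is the interval from
`vert i` to `vert (i + 1)` and has label `label i`. For finite `A` the tiles cover the line, since
their lengths are bounded below. -/
structure LabelledTiling {A : Type} (P : Protoset A) where
  vert : ℤ → ℝ
  label : ℤ → A
  vert_succ : ∀ i, vert (i + 1) = vert i + P.len (label i)

/-- A substitution rule: inflation by `infl > 1`, after which the inflated prototile `a` is
replaced by the patch `repl a` (read from left to right), which covers it exactly. -/
structure SubstitutionRule {A : Type} (P : Protoset A) where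
  infl : ℝ
  one_lt_infl : 1 < infl
  repl : A → List A
  covers : ∀ a, ((repl a).map P.len).sum = infl * P.len a

namespace LabelledTiling

variable {A : Type} {P : Protoset A}

/-- The set of vertices, i.e. the underlying geometric tiling. -/
def vertexSet (T : LabelledTiling P) : Set ℝ := Set.range T.vert

/-- `S` and `T` are the same labelled tiling, up to the numbering of the tiles. -/
def Same (S T : LabelledTiling P) : Prop :=
  ∃ m : ℤ, ∀ i, T.vert i = S.vert (i + m) ∧ T.label i = S.label (i + m)

/-- Every finite patch of `S` appears, up to translation, in `T`. -/
def PatchesIn (S T : LabelledTiling P) : Prop :=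
  ∀ (i : ℤ) (n : ℕ), ∃ j : ℤ, ∀ k : ℕ, k < n → T.label (j + k) = S.label (i + k)

/-- `S` and `T` are locally isomorphic as labelled tilings. -/
def LocallyIsomorphic (S T : LabelledTiling P) : Prop := PatchesIn S T ∧ PatchesIn T S

/-- `T = σ(S)`: the tile number `i` of `S`, inflated, is replaced by the tiles of `T` with
numbers `k i, …, k (i + 1) - 1`. -/
def IsImage (σ : SubstitutionRule P) (S T : LabelledTiling P) : Prop :=
  ∃ k : ℤ → ℤ, ∀ i,
    k (i + 1) = k i + (σ.repl (S.label i)).length ∧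
    T.vert (k i) = σ.infl * S.vert i ∧
    ∀ j : Fin (σ.repl (S.label i)).length,
      T.label (k i + ((j : ℕ) : ℤ)) = (σ.repl (S.label i)).get j

/-- `T = σⁿ(S)`. -/
def IsIterImage (σ : SubstitutionRule P) : ℕ → LabelledTiling P → LabelledTiling P → Prop
  | 0, S, T => Same S T
  | n + 1, S, T => ∃ R : LabelledTiling P, IsImage σ S R ∧ IsIterImage σ n R T

/-- `T` is a substitution tiling with substitution rule `σ`: for every `n` there is a locally
isomorphic tiling `S` with `σⁿ(S) = T`. -/
def IsSubstitutionTiling (T : LabelledTiling P) (σ : SubstitutionRule P) : Prop :=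
  ∀ n : ℕ, ∃ S : LabelledTiling P, LocallyIsomorphic S T ∧ IsIterImage σ n S T

/-- The labelling is local: the shape (the sequence of tile lengths) of a patch of bounded size
around a tile determines the label of the tile. -/
def IsLocal (T : LabelledTiling P) : Prop :=
  ∃ r : ℕ, ∀ i j : ℤ,
    (∀ k : ℤ, |k| ≤ r → P.len (T.label (i + k)) = P.len (T.label (j + k))) →
      T.label i = T.label j

end LabelledTiling

/-- The geometric tiling with vertex set `X` admits a substitution rule with inflation factor `c`:
for some finite protoset its tiles can be labelled such that it becomes a substitution tiling. -/
def AdmitsSubstitution (X : Set ℝ) (c : ℝ) : Prop :=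
  ∃ (A : Type) (_ : Finite A) (P : Protoset A) (σ : SubstitutionRule P) (T : LabelledTiling P),
    σ.infl = c ∧ T.vertexSet = X ∧ T.IsSubstitutionTiling σ

/-- Every substitution rule with inflation factor `c` that the geometric tiling with vertex set `X`
admits, for any labelling by any finite protoset, is nonlocal. -/
def OnlyNonlocal (X : Set ℝ) (c : ℝ) : Prop :=
  ∀ (A : Type) (_ : Finite A) (P : Protoset A) (σ : SubstitutionRule P) (T : LabelledTiling P),
    σ.infl = c → T.vertexSet = X → T.IsSubstitutionTiling σ → ¬ T.IsLocal

/-- The Fibonacci matrix. -/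
def fibMatrix : Matrix (Fin 2) (Fin 2) ℤ := !![1, 1; 1, 0]

/-! Write `p` and `q` for the projections of the lattice to V and Y. After replacing M by -M if
necessary, there is an automorphism φ that multiplies `p` by l = |λ| and `q` by m = ±μ, where μ is
the contracting eigenvalue. Both coordinates are injective on the lattice and `q` has dense image,
so a vertex `p g` is recognised by whether `q g` lies in Ω.

Nonlocality. Let T = σ(S) with S locally isomorphic to T and labels determined by lengths within a
radius r. The vertices of S also lie in the image of `p`, and local isomorphism forces them to be
given, up to the endpoints, by a window from a to b = a + |Ω| (`exists_window`). By locality, the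
unlabelled patch of S around a point x determines whether l·x is a vertex of T (`vertex_transfer`).
That patch, seen from `p w`, depends only on the position of `q w` relative to finitely many
translates of a and b by values of `q`. If an endpoint c of Ω were not congruent to m·a or m·b
modulo the image of `q`, the patch would be constant for `q w` near c/m, while membership of m·`q w`
in Ω changes at c, a contradiction (`exists_endpoint_eq`). Comparing both endpoints of Ω gives (1 ±
m)|Ω| in the image of `q` for some sign; multiplying by λ and using λμ = det M gives the excluded
condition.

Existence. Let |Ω| = `q e` / n and m < 0. After scaling by n the two endpoints of the window differ
by the lattice value `q e`, so one cut of the lattice describes both. Since m < 0, φ carries the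
lower endpoint to the upper endpoint of the new window, and translating by -e recovers a cut of the
same kind (`cutInflate`). Labelling a vertex by the position of the cut among finitely many lattice
points near it yields finitely many labels. The label determines the next vertex and, because φ⁻¹
contracts `p`, also the labels throughout the inflated tile (`cutLabel_cutInflate`); this is the
rule. Density of `q` makes any two such tilings locally isomorphic (`patchesIn`), and inflation of
cuts is invertible, so preimages of every order exist. Cuts as subsets, rather than real thresholds,
treat both kinds of half-open windows alike, although inflation reverses the order. -/

/-! ### Lattices with an expanding and a contracting coordinate -/

/-- An abelian group `G` with coordinates `p`, `q` which make it a lattice in the plane, and an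
automorphism `φ` which expands `p` by `l` and contracts `q` by `m`. -/
structure LatticeFrame {G : Type} [AddCommGroup G] (p q : G →+ ℝ) (φ : G ≃+ G) (l m : ℝ) :
    Prop where
  finite : ∀ R : ℝ, {g | |p g| ≤ R ∧ |q g| ≤ R}.Finite
  joint : ∀ g, p g = 0 → q g = 0 → g = 0
  map_p : ∀ g, p (φ g) = l * p g
  map_q : ∀ g, q (φ g) = m * q g
  one_lt : 1 < l
  ne_zero : m ≠ 0
  abs_lt : |m| < 1
  exists_ne : ∃ g : G, g ≠ 0

namespace LatticeFrame

variable {G : Type} [AddCommGroup G] {p q : G →+ ℝ} {φ : G ≃+ G} {l m : ℝ}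

theorem pos (F : LatticeFrame p q φ l m) : 0 < l := zero_lt_one.trans F.one_lt

theorem map_p_symm (F : LatticeFrame p q φ l m) (g : G) : p (φ.symm g) = p g / l := by
  rw [eq_div_iff F.pos.ne', mul_comm, ← F.map_p, φ.apply_symm_apply]

theorem map_q_symm (F : LatticeFrame p q φ l m) (g : G) : q (φ.symm g) = q g / m := by
  rw [eq_div_iff F.ne_zero, mul_comm, ← F.map_q, φ.apply_symm_apply]

theorem map_p_iter (F : LatticeFrame p q φ l m) (k : ℕ) (g : G) :
    p (φ^[k] g) = l ^ k * p g := by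
  induction k with
  | zero => simp
  | succ k ih => rw [Function.iterate_succ_apply', F.map_p, ih]; ring

theorem map_q_iter (F : LatticeFrame p q φ l m) (k : ℕ) (g : G) :
    q (φ^[k] g) = m ^ k * q g := by
  induction k with
  | zero => simp
  | succ k ih => rw [Function.iterate_succ_apply', F.map_q, ih]; ring

/-- Otherwise the forward orbit of g under φ would be infinite yet bounded in both coordinates. -/
theorem eq_zero_of_p (F : LatticeFrame p q φ l m) {g : G} (hg : p g = 0) : g = 0 := by
  by_contra h
  have hq : q g ≠ 0 := fun h' => h (F.joint g hg h')
  have hinj : Function.Injective fun k : ℕ => φ^[k] g := by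
    intro i j hij
    have h1 := congrArg q hij
    simp only [F.map_q_iter] at h1
    have h2 := congrArg abs (mul_right_cancel₀ hq h1)
    rw [abs_pow, abs_pow] at h2
    exact pow_right_injective₀ (abs_pos.2 F.ne_zero) F.abs_lt.ne h2
  refine Set.infinite_of_injective_forall_mem hinj (fun k => ?_) (F.finite |q g|)
  refine ⟨by simp [F.map_p_iter, hg], ?_⟩
  rw [F.map_q_iter, abs_mul, abs_pow]
  exact mul_le_of_le_one_left (abs_nonneg _) (pow_le_one₀ (abs_nonneg _) F.abs_lt.le)

/-- The mirror argument: the backward orbit would be infinite and bounded. -/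
theorem eq_zero_of_q (F : LatticeFrame p q φ l m) {g : G} (hg : q g = 0) : g = 0 := by
  by_contra h
  have hp : p g ≠ 0 := fun h' => h (F.joint g h' hg)
  have key : ∀ k : ℕ, l ^ k * p (φ.symm^[k] g) = p g ∧ q (φ.symm^[k] g) = 0 := by
    intro k
    induction k with
    | zero => simp [hg]
    | succ k ih =>
      rw [Function.iterate_succ_apply', F.map_p_symm, F.map_q_symm, ih.2]
      refine ⟨?_, by simp⟩
      rw [← ih.1]
      have := F.pos.ne'
      field_simp
      ring
  have hinj : Function.Injective fun k : ℕ => φ.symm^[k] g := by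
    intro i j hij
    have hij : φ.symm^[i] g = φ.symm^[j] g := hij
    have h1 := (key i).1
    rw [hij] at h1
    have h3 : p (φ.symm^[j] g) ≠ 0 := fun h0 => hp (by rw [← (key j).1, h0, mul_zero])
    exact pow_right_injective₀ F.pos F.one_lt.ne'
      (mul_right_cancel₀ h3 (h1.trans (key j).1.symm))
  refine Set.infinite_of_injective_forall_mem hinj (fun k => ?_) (F.finite |p g|)
  refine ⟨?_, by simp [(key k).2]⟩
  rw [← (key k).1, abs_mul, abs_pow]
  exact le_mul_of_one_le_left (abs_nonneg _) (one_le_pow₀ (by rw [abs_of_pos F.pos]; exact F.one_lt.le))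

theorem p_injective (F : LatticeFrame p q φ l m) : Function.Injective p :=
  (injective_iff_map_eq_zero p).2 fun _ => F.eq_zero_of_p

theorem exists_abs_q_lt (F : LatticeFrame p q φ l m) (g : G) {ε : ℝ} (hε : 0 < ε) :
    ∃ N : ℕ, ∀ k, N ≤ k → |q (φ^[k] g)| < ε := by
  have h := (tendsto_pow_atTop_nhds_zero_of_lt_one (abs_nonneg m) F.abs_lt).mul_const |q g|
  rw [zero_mul] at h
  obtain ⟨N, hN⟩ := Filter.eventually_atTop.1 (h.eventually (gt_mem_nhds hε))
  refine ⟨N, fun k hk => ?_⟩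
  rw [F.map_q_iter, abs_mul, abs_pow]
  exact hN k hk

/-- The iterates of a nonzero element have nonzero `q`-values tending to 0, so the image of `q` is a
dense subgroup. -/
theorem exists_q_mem_Ioo (F : LatticeFrame p q φ l m) {a b : ℝ} (hab : a < b) :
    ∃ g, q g ∈ Set.Ioo a b := by
  have hd : Dense (q.range : Set ℝ) := by
    refine AddSubgroup.dense_of_not_isolated_zero _ fun ε hε => ?_
    obtain ⟨g, hg⟩ := F.exists_ne
    obtain ⟨N, hN⟩ := F.exists_abs_q_lt g hε
    have h1 := hN N le_rfl
    have h2 : q (φ^[N] g) ≠ 0 := by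
      rw [F.map_q_iter]
      exact mul_ne_zero (pow_ne_zero _ F.ne_zero) fun h => hg (F.eq_zero_of_q h)
    rcases lt_or_gt_of_ne h2 with h | h
    · exact ⟨_, ⟨-(φ^[N] g), rfl⟩, by rw [map_neg]; linarith, by
        rw [map_neg]; linarith [_root_.abs_lt.1 h1]⟩
    · exact ⟨_, ⟨_, rfl⟩, h, (_root_.abs_lt.1 h1).2⟩
  obtain ⟨_, ⟨g, rfl⟩, h⟩ := hd.exists_between hab
  exact ⟨g, h⟩

end LatticeFrame

/-! ### The lattice `ℤ²` with the projections along the eigenlines -/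

/-- `Π_V` on `ℤ²`. -/
noncomputable def latticeProjV (v w : Fin 2 → ℝ) : (Fin 2 → ℤ) →+ ℝ where
  toFun z := projV v w (latticeVec z)
  map_zero' := by simp [projV, latticeVec]
  map_add' x y := by simp only [projV, latticeVec, Pi.add_apply, Int.cast_add]; ring

/-- `Π_Y` on `ℤ²`. -/
noncomputable def latticeProjY (v : Fin 2 → ℝ) : (Fin 2 → ℤ) →+ ℝ where
  toFun z := projY v (latticeVec z)
  map_zero' := by simp [projY, latticeVec]
  map_add' x y := by simp only [projY, latticeVec, Pi.add_apply, Int.cast_add]; ring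

/-- The automorphism of `ℤ²` given by a matrix in `GL(2, ℤ)`. -/
noncomputable def latticeAut (N : Matrix (Fin 2) (Fin 2) ℤ) (hN : IsUnit N.det) :
    (Fin 2 → ℤ) ≃+ (Fin 2 → ℤ) where
  toFun z := N.mulVec z
  invFun z := N⁻¹.mulVec z
  left_inv z := by
    change N⁻¹.mulVec (N.mulVec z) = z
    rw [Matrix.mulVec_mulVec, Matrix.nonsing_inv_mul N hN, Matrix.one_mulVec]
  right_inv z := by
    change N.mulVec (N⁻¹.mulVec z) = z
    rw [Matrix.mulVec_mulVec, Matrix.mul_nonsing_inv N hN, Matrix.one_mulVec]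
  map_add' x y := Matrix.mulVec_add N x y

namespace IsEigenFrame

variable {M : Matrix (Fin 2) (Fin 2) ℤ} {lam mu : ℝ} {v w : Fin 2 → ℝ}

theorem v_eqs (h : IsEigenFrame M lam mu v w) :
    M 0 0 * v 0 + M 0 1 * v 1 = lam * v 0 ∧ M 1 0 * v 0 + M 1 1 * v 1 = lam * v 1 := by
  have h0 := congrFun h.map_v 0
  have h1 := congrFun h.map_v 1
  simp only [Matrix.mulVec, dotProduct, Fin.sum_univ_two, Matrix.map_apply, Pi.smul_apply,
    smul_eq_mul] at h0 h1
  exact ⟨h0, h1⟩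

theorem w_eqs (h : IsEigenFrame M lam mu v w) :
    M 0 0 * w 0 + M 0 1 * w 1 = mu * w 0 ∧ M 1 0 * w 0 + M 1 1 * w 1 = mu * w 1 := by
  have h0 := congrFun h.map_w 0
  have h1 := congrFun h.map_w 1
  simp only [Matrix.mulVec, dotProduct, Fin.sum_univ_two, Matrix.map_apply, Pi.smul_apply,
    smul_eq_mul] at h0 h1
  exact ⟨h0, h1⟩

theorem det_cast : (M.det : ℝ) = M 0 0 * M 1 1 - M 0 1 * M 1 0 := by
  rw [Matrix.det_fin_two]; push_cast; ring

theorem abs_det (h : IsEigenFrame M lam mu v w) : |(M.det : ℝ)| = 1 := by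
  rcases Int.isUnit_iff.1 h.unimodular with h | h <;> simp [h]

/-- A vertical V would make M triangular with λ as an integer diagonal entry dividing det M, hence λ
= ±1. -/
theorem v_zero_ne (h : IsEigenFrame M lam mu v w) : v 0 ≠ 0 := by
  intro h0
  obtain ⟨e0, e1⟩ := h.v_eqs
  have h1 : v 1 ≠ 0 := fun h1 => h.v_ne (by ext i; fin_cases i <;> simp [h0, h1])
  rw [h0] at e0 e1
  have hb : (M 0 1 : ℝ) = 0 := by simpa [h1] using e0
  have hd : (M 1 1 : ℝ) = lam := mul_right_cancel₀ h1 (by linarith)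
  have hdet := h.unimodular
  have hb' : M 0 1 = 0 := by exact_mod_cast hb
  rw [Matrix.det_fin_two, hb', zero_mul, sub_zero] at hdet
  have h2 := isUnit_of_mul_isUnit_right hdet
  have h3 := h.expanding
  rw [← hd] at h3
  rcases Int.isUnit_iff.1 h2 with h | h <;> simp [h] at h3

theorem char_lam (h : IsEigenFrame M lam mu v w) :
    lam * (M 0 0 + M 1 1 - lam) = M.det := by
  obtain ⟨e0, e1⟩ := h.v_eqs
  rw [det_cast]
  refine mul_right_cancel₀ h.v_zero_ne ?_
  linear_combination (M 0 1 : ℝ) * e1 - (M 1 1 - lam : ℝ) * e0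

theorem cross_ne (h : IsEigenFrame M lam mu v w) : v 0 * w 1 - v 1 * w 0 ≠ 0 := by
  intro h0
  obtain ⟨e0, e1⟩ := h.v_eqs
  obtain ⟨f0, f1⟩ := h.w_eqs
  have hv := h.v_zero_ne
  have hne : lam - mu ≠ 0 := fun h' => by
    have h1 := h.expanding
    rw [sub_eq_zero.1 h'] at h1
    exact (h1.trans h.contracting).false
  have hw : w 0 ≠ 0 := fun hw => by
    rw [hw, mul_zero, sub_zero] at h0
    have : w 1 = 0 := by simpa [hv] using h0
    exact h.w_ne (by ext i; fin_cases i <;> simp [hw, this])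
  have : (lam - mu) * (v 0 * w 0) = 0 := by
    linear_combination v 0 * f0 - w 0 * e0 - (M 0 1 : ℝ) * h0
  rcases mul_eq_zero.1 this with h | h
  · exact hne h
  · exact mul_ne_zero hv hw h

theorem trace_eq (h : IsEigenFrame M lam mu v w) : (M 0 0 + M 1 1 : ℝ) = lam + mu := by
  obtain ⟨f0, f1⟩ := h.w_eqs
  have hmu : mu * (M 0 0 + M 1 1 - mu) = M.det := by
    rw [det_cast]
    have a0 : (mu * (M 0 0 + M 1 1 - mu) - (M 0 0 * M 1 1 - M 0 1 * M 1 0)) * w 0 = 0 := by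
      linear_combination (M 0 1 : ℝ) * f1 - (M 1 1 - mu : ℝ) * f0
    have a1 : (mu * (M 0 0 + M 1 1 - mu) - (M 0 0 * M 1 1 - M 0 1 * M 1 0)) * w 1 = 0 := by
      linear_combination (M 1 0 : ℝ) * f0 - (M 0 0 - mu : ℝ) * f1
    by_contra hne
    have hne := sub_ne_zero.2 hne
    refine h.w_ne ?_
    ext i
    fin_cases i
    · exact (mul_eq_zero.1 a0).resolve_left hne
    · exact (mul_eq_zero.1 a1).resolve_left hne
  have hne : lam - mu ≠ 0 := fun h' => by
    have h1 := h.expanding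
    rw [sub_eq_zero.1 h'] at h1
    exact (h1.trans h.contracting).false
  refine mul_left_cancel₀ hne ?_
  linear_combination h.char_lam - hmu

theorem lam_mul_mu (h : IsEigenFrame M lam mu v w) : lam * mu = M.det := by
  linear_combination h.char_lam - lam * h.trace_eq

theorem projV_mulVec (h : IsEigenFrame M lam mu v w) (z : Fin 2 → ℤ) :
    latticeProjV v w (M.mulVec z) = lam * latticeProjV v w z := by
  obtain ⟨f0, f1⟩ := h.w_eqs
  simp only [latticeProjV, AddMonoidHom.coe_mk, ZeroHom.coe_mk, projV, latticeVec, Matrix.mulVec,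
    dotProduct, Fin.sum_univ_two]
  rw [← mul_div_assoc]
  congr 1
  push_cast
  linear_combination (z 1 : ℝ) * f0 - (z 0 : ℝ) * f1 + ((z 0 : ℝ) * w 1 - z 1 * w 0) * h.trace_eq

theorem projY_mulVec (h : IsEigenFrame M lam mu v w) (z : Fin 2 → ℤ) :
    latticeProjY v (M.mulVec z) = mu * latticeProjY v z := by
  obtain ⟨e0, e1⟩ := h.v_eqs
  have hv := h.v_zero_ne
  simp only [latticeProjY, AddMonoidHom.coe_mk, ZeroHom.coe_mk, projY, latticeVec, Matrix.mulVec,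
    dotProduct, Fin.sum_univ_two]
  field_simp
  push_cast
  linear_combination (z 0 : ℝ) * e1 - (z 1 : ℝ) * e0 + ((z 1 : ℝ) * v 0 - z 0 * v 1) * h.trace_eq

theorem projV_neg_mulVec (h : IsEigenFrame M lam mu v w) (z : Fin 2 → ℤ) :
    latticeProjV v w ((-M).mulVec z) = -lam * latticeProjV v w z := by
  rw [Matrix.neg_mulVec, map_neg, h.projV_mulVec]; ring

theorem projY_neg_mulVec (h : IsEigenFrame M lam mu v w) (z : Fin 2 → ℤ) :
    latticeProjY v ((-M).mulVec z) = -mu * latticeProjY v z := by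
  rw [Matrix.neg_mulVec, map_neg, h.projY_mulVec]; ring

/-- Recovering the integer coordinates linearly from the two projections is what gives discreteness
and joint injectivity. -/
theorem apply_zero_eq (h : IsEigenFrame M lam mu v w) (z : Fin 2 → ℤ) :
    (z 0 : ℝ) = v 0 * latticeProjV v w z +
      (v 0 * w 0 / (v 0 * w 1 - v 1 * w 0)) * latticeProjY v z := by
  have hv := h.v_zero_ne
  have hc := h.cross_ne
  simp only [latticeProjV, latticeProjY, AddMonoidHom.coe_mk, ZeroHom.coe_mk, projV, projY,
    latticeVec]
  set D := v 0 * w 1 - v 1 * w 0 with hD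
  field_simp
  rw [hD]
  ring

theorem apply_one_eq (z : Fin 2 → ℤ) :
    (z 1 : ℝ) = latticeProjY v z + v 1 / v 0 * z 0 := by
  simp only [latticeProjY, AddMonoidHom.coe_mk, ZeroHom.coe_mk, projY, latticeVec]
  ring

theorem finite_bounded (h : IsEigenFrame M lam mu v w) (R : ℝ) :
    {z | |latticeProjV v w z| ≤ R ∧ |latticeProjY v z| ≤ R}.Finite := by
  set α := v 0 * w 0 / (v 0 * w 1 - v 1 * w 0)
  set C0 := |v 0| * R + |α| * R
  set C1 := R + |v 1 / v 0| * C0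
  refine (Set.finite_Icc (fun i : Fin 2 => if i = 0 then -⌈C0⌉ else -⌈C1⌉)
    (fun i => if i = 0 then ⌈C0⌉ else ⌈C1⌉)).subset ?_
  rintro z ⟨hp, hq⟩
  have h0 : |(z 0 : ℝ)| ≤ C0 := by
    rw [h.apply_zero_eq z]
    refine (abs_add_le _ _).trans ?_
    rw [abs_mul, abs_mul]
    exact add_le_add (mul_le_mul_of_nonneg_left hp (abs_nonneg _))
      (mul_le_mul_of_nonneg_left hq (abs_nonneg _))
  have h1 : |(z 1 : ℝ)| ≤ C1 := by
    rw [apply_one_eq (v := v) z]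
    refine (abs_add_le _ _).trans ?_
    rw [abs_mul]
    exact add_le_add hq (mul_le_mul_of_nonneg_left h0 (abs_nonneg _))
  have key : ∀ (x : ℤ) (C : ℝ), |(x : ℝ)| ≤ C → -⌈C⌉ ≤ x ∧ x ≤ ⌈C⌉ := by
    intro x C hx
    have := hx.trans (Int.le_ceil C)
    exact abs_le.1 (by exact_mod_cast this)
  constructor <;> intro i <;> fin_cases i
  · exact (key _ _ h0).1
  · exact (key _ _ h1).1
  · exact (key _ _ h0).2
  · exact (key _ _ h1).2

theorem joint (h : IsEigenFrame M lam mu v w) (z : Fin 2 → ℤ) (hp : latticeProjV v w z = 0)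
    (hq : latticeProjY v z = 0) : z = 0 := by
  have h0 := h.apply_zero_eq z
  have h1 := apply_one_eq (v := v) z
  rw [hp, hq] at h0
  rw [hq, h0] at h1
  ext i
  fin_cases i
  · simpa using h0
  · simpa using h1

theorem lam_ne (h : IsEigenFrame M lam mu v w) : lam ≠ 0 := fun h0 => by
  have := h.expanding
  rw [h0] at this
  norm_num at this

theorem mu_ne (h : IsEigenFrame M lam mu v w) : mu ≠ 0 := fun h0 => by
  have h1 := h.lam_mul_mu
  have h2 := h.abs_det
  rw [← h1, h0] at h2
  simp at h2

/-- A frame given by `M` itself. -/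
theorem latticeFrame_of_pos (h : IsEigenFrame M lam mu v w) (hl : 0 < lam) :
    LatticeFrame (latticeProjV v w) (latticeProjY v) (latticeAut M h.unimodular) lam mu where
  finite := h.finite_bounded
  joint := h.joint
  map_p := h.projV_mulVec
  map_q := h.projY_mulVec
  one_lt := by simpa [abs_of_pos hl] using h.expanding
  ne_zero := h.mu_ne
  abs_lt := h.contracting
  exists_ne := ⟨fun _ => 1, fun h => one_ne_zero (congrFun h 0)⟩

/-- A frame which inflates by `|lam|`, given by `M` or `-M`. -/
theorem exists_latticeFrame (h : IsEigenFrame M lam mu v w) :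
    ∃ (φ : (Fin 2 → ℤ) ≃+ (Fin 2 → ℤ)) (m : ℝ),
      LatticeFrame (latticeProjV v w) (latticeProjY v) φ |lam| m ∧ (m = mu ∨ m = -mu) := by
  rcases lt_or_gt_of_ne h.lam_ne with hl | hl
  · have hu : IsUnit (-M).det := by
      rw [Matrix.det_neg]; simpa using h.unimodular
    refine ⟨latticeAut (-M) hu, -mu, ⟨h.finite_bounded, h.joint, ?_, h.projY_neg_mulVec,
      h.expanding, neg_ne_zero.2 h.mu_ne, by simpa using h.contracting,
      ⟨fun _ => 1, fun h => one_ne_zero (congrFun h 0)⟩⟩, Or.inr rfl⟩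
    rw [abs_of_neg hl]
    exact h.projV_neg_mulVec
  · refine ⟨latticeAut M h.unimodular, mu, ?_, Or.inl rfl⟩
    rw [abs_of_pos hl]
    exact h.latticeFrame_of_pos hl

theorem coe_adjoin_int_eq (x : ℝ) (a b : ℤ) (hx : x * x = a * x + b) :
    (Algebra.adjoin ℤ {x} : Set ℝ) = {y | ∃ c d : ℤ, y = c + d * x} := by
  ext y
  constructor
  · intro hy
    refine Algebra.adjoin_induction (p := fun y _ => ∃ c d : ℤ, y = c + d * x) ?_ ?_ ?_ ?_ hy
    · rintro _ rfl
      exact ⟨0, 1, by simp⟩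
    · intro r
      exact ⟨r, 0, by simp⟩
    · rintro _ _ _ _ ⟨c, d, rfl⟩ ⟨c', d', rfl⟩
      exact ⟨c + c', d + d', by push_cast; ring⟩
    · rintro _ _ _ _ ⟨c, d, rfl⟩ ⟨c', d', rfl⟩
      exact ⟨c * c' + d * d' * b, c * d' + d * c' + d * d' * a, by
        push_cast; linear_combination (d * d' : ℝ) * hx⟩
  · rintro ⟨c, d, rfl⟩
    have hx := Algebra.self_mem_adjoin_singleton ℤ x
    exact add_mem (intCast_mem _ c) (mul_mem (intCast_mem _ d) hx)

theorem latticeProj_eq_adjoin (h : IsEigenFrame M lam mu v w) (hb : |M 0 1| = 1) :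
    latticeProj v = (Algebra.adjoin ℤ {lam} : Set ℝ) := by
  obtain ⟨e0, -⟩ := h.v_eqs
  have hv := h.v_zero_ne
  rw [coe_adjoin_int_eq lam (M 0 0 + M 1 1) (-M.det)
    (by rw [Int.cast_add, Int.cast_neg]; linear_combination -h.char_lam)]
  have hb2 : (M 0 1 : ℝ) * M 0 1 = 1 := by
    have : M 0 1 * M 0 1 = 1 := by rw [← abs_mul_abs_self, hb, mul_one]
    exact_mod_cast this
  -- An entry ±1 is its own inverse, so the slope of V is an integral expression in λ.
  have hs : v 1 / v 0 = M 0 1 * (lam - M 0 0) := by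
    rw [div_eq_iff hv]
    linear_combination (M 0 1 : ℝ) * e0 - v 1 * hb2
  ext y
  constructor
  · rintro ⟨z, rfl⟩
    refine ⟨z 1 + z 0 * (M 0 1 * M 0 0), -(z 0 * M 0 1), ?_⟩
    simp only [projY, latticeVec, hs]
    push_cast
    ring
  · rintro ⟨c, d, rfl⟩
    refine ⟨![-(d * M 0 1), c + d * M 0 0], ?_⟩
    simp only [projY, latticeVec, hs, Matrix.cons_val_zero, Matrix.cons_val_one]
    push_cast
    linear_combination (d * (lam - M 0 0) : ℝ) * hb2

end IsEigenFrame

/-! ### Labelled tilings of the line -/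

namespace LabelledTiling

variable {A : Type} {P : Protoset A}

theorem vert_strictMono (T : LabelledTiling P) : StrictMono T.vert :=
  strictMono_int_of_lt_succ fun i => by
    rw [T.vert_succ]; linarith [P.len_pos (T.label i)]

theorem vert_add_natCast_eq {S T : LabelledTiling P} {i j : ℤ} {n : ℕ}
    (h : ∀ k : ℕ, k < n → T.label (j + k) = S.label (i + k)) (k : ℕ) (hk : k ≤ n) :
    T.vert (j + k) - T.vert j = S.vert (i + k) - S.vert i := by
  induction k with
  | zero => simp
  | succ k ih =>
    have h1 := ih (by omega)
    have h2 := h k (by omega)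
    push_cast
    rw [← add_assoc, ← add_assoc, T.vert_succ, S.vert_succ, h2]
    linarith

theorem exists_le_len [Finite A] (T : LabelledTiling P) : ∃ ε > 0, ∀ a, ε ≤ P.len a := by
  have : Nonempty A := ⟨T.label 0⟩
  obtain ⟨a, ha⟩ := Finite.exists_min P.len
  exact ⟨_, P.len_pos a, ha⟩

theorem exists_len_le [Finite A] (T : LabelledTiling P) : ∃ D > 0, ∀ a, P.len a ≤ D := by
  have : Nonempty A := ⟨T.label 0⟩
  obtain ⟨a, ha⟩ := Finite.exists_max P.len
  exact ⟨_, P.len_pos a, ha⟩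

theorem vert_add_natCast_ge (T : LabelledTiling P) {ε : ℝ} (hε : ∀ a, ε ≤ P.len a) (i : ℤ)
    (n : ℕ) : T.vert i + n * ε ≤ T.vert (i + n) := by
  induction n with
  | zero => simp
  | succ n ih =>
    push_cast
    rw [← add_assoc, T.vert_succ]
    linarith [hε (T.label (i + n))]

theorem vert_add_natCast_le (T : LabelledTiling P) {D : ℝ} (hD : ∀ a, P.len a ≤ D) (i : ℤ)
    (n : ℕ) : T.vert (i + n) ≤ T.vert i + n * D := by
  induction n with
  | zero => simp
  | succ n ih =>
    push_cast
    rw [← add_assoc, T.vert_succ]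
    linarith [hD (T.label (i + n))]

theorem abs_vert_sub_le (T : LabelledTiling P) {D : ℝ} (hD : ∀ a, P.len a ≤ D) (i k : ℤ) :
    |T.vert (i + k) - T.vert i| ≤ |k| * D := by
  obtain ⟨n, rfl | rfl⟩ := k.eq_nat_or_neg
  · have h1 := T.vert_add_natCast_le hD i n
    have h2 : T.vert i ≤ T.vert (i + n) := T.vert_strictMono.monotone (by omega)
    rw [abs_of_nonneg (by linarith)]
    simp only [Nat.abs_cast, Int.cast_natCast]
    linarith
  · have h1 := T.vert_add_natCast_le hD (i + -n) n
    have h2 : T.vert (i + -n) ≤ T.vert i := T.vert_strictMono.monotone (by omega)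
    rw [neg_add_cancel_right] at h1
    rw [abs_of_nonpos (by linarith)]
    simp only [abs_neg, Nat.abs_cast, Int.cast_natCast]
    linarith

theorem exists_le_vert [Finite A] (T : LabelledTiling P) (x : ℝ) : ∃ i, x ≤ T.vert i := by
  obtain ⟨ε, h0, hε⟩ := T.exists_le_len
  obtain ⟨n, hn⟩ := exists_nat_ge ((x - T.vert 0) / ε)
  rw [div_le_iff₀ h0] at hn
  exact ⟨0 + n, by linarith [T.vert_add_natCast_ge hε 0 n]⟩

theorem exists_vert_le [Finite A] (T : LabelledTiling P) (x : ℝ) : ∃ i, T.vert i ≤ x := by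
  obtain ⟨ε, h0, hε⟩ := T.exists_le_len
  obtain ⟨n, hn⟩ := exists_nat_ge ((T.vert 0 - x) / ε)
  rw [div_le_iff₀ h0] at hn
  refine ⟨-n, ?_⟩
  have := T.vert_add_natCast_ge hε (-n) n
  rw [neg_add_cancel] at this
  linarith

theorem exists_tile [Finite A] (T : LabelledTiling P) (x : ℝ) :
    ∃ i, T.vert i ≤ x ∧ x < T.vert (i + 1) := by
  obtain ⟨b, hb⟩ := T.exists_le_vert x
  obtain ⟨i, h1, h2⟩ := Int.exists_greatest_of_bdd (P := fun i => T.vert i ≤ x)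
    ⟨b, fun z hz => T.vert_strictMono.le_iff_le.1 (hz.trans hb)⟩ (T.exists_vert_le x)
  exact ⟨i, h1, lt_of_not_ge fun h => absurd (h2 _ h) (by omega)⟩

theorem PatchesIn.exists_shift_label {S T : LabelledTiling P} (h : PatchesIn S T) (a b : ℤ) :
    ∃ s : ℤ, ∀ c, a ≤ c → c < b → T.label (c + s) = S.label c := by
  obtain ⟨j, hj⟩ := h a (b - a).toNat
  refine ⟨j - a, fun c h1 h2 => ?_⟩
  have := hj (c - a).toNat (by omega)
  rwa [show a + ((c - a).toNat : ℤ) = c by omega,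
    show j + ((c - a).toNat : ℤ) = c + (j - a) by omega] at this

theorem PatchesIn.exists_shift [Finite A] {S T : LabelledTiling P} (h : PatchesIn S T) (R : ℝ) :
    ∃ δ, ∀ x, |x| ≤ R → (x ∈ S.vertexSet ↔ x + δ ∈ T.vertexSet) := by
  obtain ⟨i, hi⟩ := S.exists_vert_le (-R)
  obtain ⟨i', hi'⟩ := S.exists_le_vert R
  obtain ⟨j, hj⟩ := h i (i' - i).toNat
  have key := vert_add_natCast_eq hj
  refine ⟨T.vert j - S.vert i, fun x hx => ?_⟩
  have hx := abs_le.1 hx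
  have hii : i ≤ i' := S.vert_strictMono.le_iff_le.1 (by linarith)
  constructor
  · rintro ⟨a, rfl⟩
    have h1 : i ≤ a := S.vert_strictMono.le_iff_le.1 (by linarith)
    have h2 : a ≤ i' := S.vert_strictMono.le_iff_le.1 (by linarith)
    refine ⟨j + (a - i).toNat, ?_⟩
    have := key (a - i).toNat (by omega)
    rw [show i + ((a - i).toNat : ℤ) = a by omega] at this
    linarith
  · rintro ⟨b, hb⟩
    have hend := key (i' - i).toNat le_rfl
    rw [show i + ((i' - i).toNat : ℤ) = i' by omega] at hend
    have h1 : j ≤ b := T.vert_strictMono.le_iff_le.1 (by linarith)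
    have h2 : b ≤ j + (i' - i).toNat := T.vert_strictMono.le_iff_le.1 (by linarith)
    refine ⟨i + (b - j).toNat, ?_⟩
    have := key (b - j).toNat (by omega)
    rw [show j + ((b - j).toNat : ℤ) = b by omega] at this
    linarith

/-- Because the equivalence `H` goes both ways, no vertex can appear between two translated
neighbours, so consecutive vertices go to consecutive vertices. -/
theorem exists_index_shift (S : LabelledTiling P) {δ x₀ R : ℝ}
    (H : ∀ x, |x - x₀| ≤ R → (x ∈ S.vertexSet ↔ x + δ ∈ S.vertexSet)) (i : ℤ) (r : ℕ)
    (hR : ∀ k : ℤ, |k| ≤ r → |S.vert (i + k) - x₀| ≤ R) :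
    ∃ j, ∀ k : ℤ, |k| ≤ r → S.vert (j + k) = S.vert (i + k) + δ := by
  have hex : ∀ k : ℤ, |k| ≤ r → ∃ j, S.vert j = S.vert (i + k) + δ := fun k hk =>
    (H _ (hR k hk)).1 ⟨_, rfl⟩
  have step : ∀ k : ℤ, |k| ≤ r → |k + 1| ≤ r → ∀ j, S.vert j = S.vert (i + k) + δ →
      S.vert (j + 1) = S.vert (i + (k + 1)) + δ := by
    intro k hk hk1 j hj
    obtain ⟨b, hb⟩ := hex (k + 1) hk1
    have hlt : S.vert (i + k) < S.vert (i + (k + 1)) := S.vert_strictMono (by omega)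
    have h1 : j < b := S.vert_strictMono.lt_iff_lt.1 (by linarith)
    have h2 : S.vert (j + 1) ≤ S.vert b := S.vert_strictMono.monotone h1
    have h3 : S.vert j < S.vert (j + 1) := S.vert_strictMono (by omega)
    have b1 := abs_le.1 (hR k hk)
    have b2 := abs_le.1 (hR (k + 1) hk1)
    obtain ⟨c, hc⟩ := (H (S.vert (j + 1) - δ) (abs_le.2 ⟨by linarith, by linarith⟩)).2
      ⟨j + 1, by ring⟩
    have h4 : i + k < c := S.vert_strictMono.lt_iff_lt.1 (by linarith)
    have h5 : c ≤ i + (k + 1) := S.vert_strictMono.le_iff_le.1 (by linarith)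
    rw [show i + (k + 1) = c by omega]
    linarith
  obtain ⟨j₀, hj₀⟩ := hex (-r) (by simp)
  have main : ∀ n : ℕ, n ≤ 2 * r → S.vert (j₀ + n) = S.vert (i + (-r + n)) + δ := by
    intro n
    induction n with
    | zero => intro _; simpa using hj₀
    | succ n ih =>
      intro hn
      have := step (-r + n) (abs_le.2 ⟨by omega, by omega⟩) (abs_le.2 ⟨by omega, by omega⟩) _
        (ih (by omega))
      push_cast
      rw [← add_assoc, this, add_assoc (-r : ℤ)]
  refine ⟨j₀ + r, fun k hk => ?_⟩
  have hk := abs_le.1 hk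
  have := main (k + r).toNat (by omega)
  rwa [show j₀ + ((k + r).toNat : ℤ) = j₀ + r + k by omega,
    show i + (-(r : ℤ) + ((k + r).toNat : ℤ)) = i + k by omega] at this

/-! ### Consequences of locality -/

/-- Locality with radius `r`. -/
def IsLocalWith (T : LabelledTiling P) (r : ℕ) : Prop :=
  ∀ i j : ℤ, (∀ k : ℤ, |k| ≤ r → P.len (T.label (i + k)) = P.len (T.label (j + k))) →
    T.label i = T.label j

theorem IsLocalWith.of_patchesIn {S T : LabelledTiling P} {r : ℕ} (hT : T.IsLocalWith r)
    (h : PatchesIn S T) : S.IsLocalWith r := by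
  intro i j hij
  obtain ⟨s, hs⟩ := h.exists_shift_label (min i j - r) (max i j + r + 1)
  rw [← hs i (by omega) (by omega), ← hs j (by omega) (by omega)]
  refine hT _ _ fun k hk => ?_
  have hk' := abs_le.1 hk
  rw [show i + s + k = i + k + s by ring, show j + s + k = j + k + s by ring,
    hs (i + k) (by omega) (by omega), hs (j + k) (by omega) (by omega)]
  exact hij k hk

theorem IsIterImage.isImage {σ : SubstitutionRule P} {S T : LabelledTiling P}
    (h : IsIterImage σ 1 S T) : IsImage σ S T := by
  obtain ⟨R, ⟨k, hk⟩, m, hm⟩ := h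
  have hm' : ∀ i, R.vert i = T.vert (i - m) ∧ R.label i = T.label (i - m) := fun i => by
    have := hm (i - m)
    rw [sub_add_cancel] at this
    exact ⟨this.1.symm, this.2.symm⟩
  refine ⟨fun i => k i - m, fun i => ⟨?_, ?_, fun j => ?_⟩⟩
  · change k (i + 1) - m = k i - m + _
    rw [(hk i).1]; ring
  · rw [← (hm' _).1, (hk i).2.1]
  · rw [← (hk i).2.2 j, (hm' _).2]
    congr 1
    ring

/-- The tile of S containing x₀ and its translate have the same neighbours, hence by locality the
same label and the same replacement patch. The shape of S near x₀ therefore decides whether the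
inflated point is a vertex. -/
theorem IsImage.vertex_transfer [Finite A] {σ : SubstitutionRule P} {S T : LabelledTiling P}
    (h : IsImage σ S T) {r : ℕ} (hr : S.IsLocalWith r) {D : ℝ} (hD : ∀ a, P.len a ≤ D)
    {x₀ δ : ℝ}
    (H : ∀ x, |x - x₀| ≤ (r + 2) * D → (x ∈ S.vertexSet ↔ x + δ ∈ S.vertexSet))
    (hx : σ.infl * x₀ ∈ T.vertexSet) : σ.infl * (x₀ + δ) ∈ T.vertexSet := by
  obtain ⟨k, hk⟩ := h
  obtain ⟨i, hi1, hi2⟩ := S.exists_tile x₀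
  have hpos : 0 < σ.infl := zero_lt_one.trans σ.one_lt_infl
  -- Lengths of r neighbours on each side need vertices up to index r + 1; one more tile length
  -- accounts for the distance from x₀ to its tile's left end, whence the radius (r + 2)·D.
  obtain ⟨j, hj⟩ := S.exists_index_shift H i (r + 1) fun n hn => by
    have h1 := S.abs_vert_sub_le hD i n
    have h2 : (|n| : ℝ) ≤ r + 1 := by exact_mod_cast hn
    have h3 := S.vert_succ i
    have h4 := hD (S.label i)
    have h5 := P.len_pos (S.label i)
    have h6 : (|n| : ℝ) * D ≤ (r + 1) * D := mul_le_mul_of_nonneg_right h2 (by linarith)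
    rw [Int.cast_abs] at h1
    rw [abs_le] at h1 ⊢
    constructor <;> linarith
  have hlab : S.label i = S.label j := by
    refine hr i j fun n hn => ?_
    have hn' := abs_le.1 hn
    have h1 := hj n (abs_le.2 ⟨by push_cast; omega, by push_cast; omega⟩)
    have h2 := hj (n + 1) (abs_le.2 ⟨by push_cast; omega, by push_cast; omega⟩)
    rw [← add_assoc, ← add_assoc, S.vert_succ, S.vert_succ] at h2
    linarith
  have hj0 := hj 0 (by simp; omega)
  rw [add_zero, add_zero] at hj0
  obtain ⟨c, hc⟩ := hx
  have e1 := (hk i).2.1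
  have e2 := (hk (i + 1)).2.1
  have c1 : k i ≤ c := T.vert_strictMono.le_iff_le.1 (by
    rw [e1, hc]; exact mul_le_mul_of_nonneg_left hi1 hpos.le)
  have c2 : c < k (i + 1) := T.vert_strictMono.lt_iff_lt.1 (by
    rw [e2, hc]; exact mul_lt_mul_of_pos_left hi2 hpos)
  rw [(hk i).1] at c2
  have hl : ∀ n : ℕ, n < (σ.repl (S.label i)).length → T.label (k j + n) = T.label (k i + n) := by
    intro n hn
    have h1 := (hk i).2.2 ⟨n, hn⟩
    have h2 := (hk j).2.2 ⟨n, hlab ▸ hn⟩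
    rw [h1, h2]
    simp only [List.get_eq_getElem, hlab]
  have := vert_add_natCast_eq hl (c - k i).toNat (by omega)
  rw [show k i + ((c - k i).toNat : ℤ) = c by omega, hc, e1, (hk j).2.1, hj0] at this
  exact ⟨_, by linear_combination this⟩

end LabelledTiling

/-! ### A local substitution rule relates the endpoints of the window -/

theorem Set.Finite.exists_pos_lt {α : Type*} {s : Set α} (hs : s.Finite) {f : α → ℝ}
    (hf : ∀ x ∈ s, 0 < f x) {b : ℝ} (hb : 0 < b) : ∃ ε, 0 < ε ∧ ε < b ∧ ∀ x ∈ s, ε < f x := by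
  have h1 : ∀ᶠ ε in nhdsWithin (0 : ℝ) (Set.Ioi 0), ∀ x ∈ s, ε < f x :=
    (Filter.eventually_all_finite hs).2 fun x hx =>
      nhdsWithin_le_nhds (gt_mem_nhds (hf x hx))
  have h2 : ∀ᶠ ε in nhdsWithin (0 : ℝ) (Set.Ioi 0), ε < b := nhdsWithin_le_nhds (gt_mem_nhds hb)
  obtain ⟨ε, ⟨h1, h2⟩, h3⟩ := ((h1.and h2).and self_mem_nhdsWithin).exists
  exact ⟨ε, h3, h2, h1⟩

namespace LatticeFrame

open LabelledTiling

variable {G : Type} [AddCommGroup G] {p q : G →+ ℝ} {φ : G ≃+ G} {l m : ℝ}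
  {A : Type} [Finite A] {P : Protoset A} {S T : LabelledTiling P}

/-- Including `S.vert 0` in the patch makes the translation a difference of two vertices, so it
comes from the lattice. -/
theorem exists_lattice_shift (h : PatchesIn S T) (hS : S.vertexSet ⊆ Set.range p)
    (hT : T.vertexSet ⊆ Set.range p) (R : ℝ) :
    ∃ u, ∀ g, |p g| ≤ R → (p g ∈ S.vertexSet ↔ p (g + u) ∈ T.vertexSet) := by
  have h0 : S.vert 0 ∈ S.vertexSet := ⟨0, rfl⟩
  obtain ⟨δ, hδ⟩ := h.exists_shift (max R |S.vert 0|)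
  obtain ⟨g₀, hg₀⟩ := hS h0
  obtain ⟨g₁, hg₁⟩ := hT ((hδ _ (le_max_right _ _)).1 h0)
  refine ⟨g₁ - g₀, fun g hg => ?_⟩
  rw [hδ _ (hg.trans (le_max_left _ _)), map_add, map_sub, hg₁, hg₀, add_sub_cancel_left]

/-- The preimage of the vertices of `S` is given by a window with endpoints `a`, `b`. -/
theorem exists_window (F : LatticeFrame p q φ l m) (h : LocallyIsomorphic S T)
    (hS : S.vertexSet ⊆ Set.range p) (hT : T.vertexSet ⊆ Set.range p) {Ω : Set ℝ} {t L : ℝ}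
    (hL : 0 < L) (hTΩ : ∀ g, p g ∈ T.vertexSet ↔ q g ∈ Ω) (hΩ₁ : Set.Ioo t (t + L) ⊆ Ω)
    (hΩ₂ : Ω ⊆ Set.Icc t (t + L)) (hΩ₃ : Ω.OrdConnected) :
    ∃ a b, b - a = L ∧ (∀ g, p g ∈ S.vertexSet → a ≤ q g ∧ q g ≤ b) ∧
      ∀ g, a < q g → q g < b → p g ∈ S.vertexSet := by
  set W := {x | ∃ g, p g ∈ S.vertexSet ∧ q g = x} with hW
  -- Spread at most L and convexity each concern only two or three points, so they pass from T to S
  -- through a single patch.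
  have f1 : ∀ g₁ g₂, p g₁ ∈ S.vertexSet → p g₂ ∈ S.vertexSet → q g₂ ≤ q g₁ + L := by
    intro g₁ g₂ h₁ h₂
    obtain ⟨u, hu⟩ := exists_lattice_shift h.1 hS hT (max |p g₁| |p g₂|)
    have h₁ := hΩ₂ ((hTΩ _).1 ((hu g₁ (le_max_left _ _)).1 h₁))
    have h₂ := hΩ₂ ((hTΩ _).1 ((hu g₂ (le_max_right _ _)).1 h₂))
    rw [map_add] at h₁ h₂
    linarith [h₁.1, h₂.2]
  have f2 : ∀ g g₁ g₂, p g₁ ∈ S.vertexSet → p g₂ ∈ S.vertexSet → q g₁ ≤ q g → q g ≤ q g₂ →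
      p g ∈ S.vertexSet := by
    intro g g₁ g₂ h₁ h₂ l₁ l₂
    obtain ⟨u, hu⟩ := exists_lattice_shift h.1 hS hT (max |p g| (max |p g₁| |p g₂|))
    have h₁ := (hTΩ _).1 ((hu g₁ ((le_max_left _ _).trans (le_max_right _ _))).1 h₁)
    have h₂ := (hTΩ _).1 ((hu g₂ ((le_max_right _ _).trans (le_max_right _ _))).1 h₂)
    refine (hu g (le_max_left _ _)).2 ((hTΩ _).2 (hΩ₃.out h₁ h₂ ?_))
    simp only [map_add]
    exact ⟨by linarith, by linarith⟩
  obtain ⟨g₀, hg₀⟩ := hS (⟨0, rfl⟩ : S.vert 0 ∈ S.vertexSet)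
  have hg₀' : p g₀ ∈ S.vertexSet := hg₀ ▸ ⟨0, rfl⟩
  have hne : W.Nonempty := ⟨_, g₀, hg₀', rfl⟩
  have hbb : BddBelow W := ⟨q g₀ - L, by rintro _ ⟨g, hg, rfl⟩; linarith [f1 g g₀ hg hg₀']⟩
  have hba : BddAbove W := ⟨q g₀ + L, by rintro _ ⟨g, hg, rfl⟩; exact f1 g₀ g hg₀' hg⟩
  refine ⟨sInf W, sSup W, le_antisymm ?_ ?_, fun g hg => ⟨csInf_le hbb ⟨g, hg, rfl⟩,
    le_csSup hba ⟨g, hg, rfl⟩⟩, fun g h₁ h₂ => ?_⟩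
  · rw [sub_le_iff_le_add']
    refine csSup_le hne ?_
    rintro _ ⟨g₂, h₂, rfl⟩
    rw [← sub_le_iff_le_add]
    refine le_csInf hne ?_
    rintro _ ⟨g₁, h₁, rfl⟩
    linarith [f1 g₁ g₂ h₁ h₂]
  · refine le_of_forall_pos_le_add fun ε hε => ?_
    set η := min (ε / 2) L with hη
    have hη0 : 0 < η := lt_min (by linarith) hL
    have hη1 : η ≤ ε / 2 := min_le_left _ _
    have hη2 : η ≤ L := min_le_right _ _
    obtain ⟨g₁, h₁, h₁'⟩ := F.exists_q_mem_Ioo (show t < t + η by linarith)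
    obtain ⟨g₂, h₂, h₂'⟩ := F.exists_q_mem_Ioo (show t + L - η < t + L by linarith)
    obtain ⟨u, hu⟩ := exists_lattice_shift h.2 hT hS (max |p g₁| |p g₂|)
    have k₁ := (hu g₁ (le_max_left _ _)).1 ((hTΩ _).2 (hΩ₁ ⟨h₁, by linarith⟩))
    have k₂ := (hu g₂ (le_max_right _ _)).1 ((hTΩ _).2 (hΩ₁ ⟨by linarith, h₂'⟩))
    have i₁ := csInf_le hbb ⟨_, k₁, rfl⟩
    have i₂ := le_csSup hba ⟨_, k₂, rfl⟩
    rw [map_add] at i₁ i₂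
    linarith
  · obtain ⟨_, ⟨g₁, k₁, rfl⟩, l₁⟩ := exists_lt_of_csInf_lt hne h₁
    obtain ⟨_, ⟨g₂, k₂, rfl⟩, l₂⟩ := exists_lt_of_lt_csSup hne h₂
    exact f2 g g₁ g₂ k₁ k₂ l₁.le l₂.le

/-- Every endpoint `c` of the window of a tiling with local substitution rule agrees modulo the
lattice with an endpoint of the window of the inflated tiling. -/
theorem exists_endpoint_eq (F : LatticeFrame p q φ l m) {σ : SubstitutionRule P}
    (hσ : σ.infl = l) (him : IsImage σ S T) {r : ℕ} (hr : S.IsLocalWith r)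
    (hS : S.vertexSet ⊆ Set.range p) {Ω : Set ℝ} (hTΩ : ∀ g, p g ∈ T.vertexSet ↔ q g ∈ Ω)
    {a b : ℝ} (hab : ∀ g, p g ∈ S.vertexSet → a ≤ q g ∧ q g ≤ b)
    (hab' : ∀ g, a < q g → q g < b → p g ∈ S.vertexSet) {c L : ℝ} (hL : 0 < L)
    (hc : ∀ x y, c - L < x → x < c → c < y → y < c + L → ¬(x ∈ Ω ↔ y ∈ Ω)) :
    ∃ u, c + q u = m * a ∨ c + q u = m * b := by
  by_contra! hcon
  have hm := F.ne_zero
  set d := c / m with hd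
  have hcd : c = m * d := by rw [hd]; field_simp
  have hne : ∀ g, d + q g ≠ a ∧ d + q g ≠ b := fun g => by
    have := hcon (φ g)
    rw [F.map_q, hcd, ← mul_add] at this
    exact ⟨fun h => this.1 (by rw [h]), fun h => this.2 (by rw [h])⟩
  obtain ⟨D, hD0, hD⟩ := S.exists_len_le
  set R := ((r : ℝ) + 2) * D with hR
  -- If |`q g`| exceeds this bound, then d + `q g` and all points within distance 1 of it miss the
  -- window, so only finitely many g matter.
  set Q := |d| + 1 + |a| + |b| with hQ
  have hfin : {g | |p g| ≤ R ∧ |q g| ≤ Q}.Finite :=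
    (F.finite (max R Q)).subset fun g hg => ⟨hg.1.trans (le_max_left _ _),
      hg.2.trans (le_max_right _ _)⟩
  obtain ⟨ε, hε0, hε1, hε⟩ := hfin.exists_pos_lt
    (f := fun g => min |d + q g - a| |d + q g - b|)
    (fun g _ => lt_min (abs_pos.2 (sub_ne_zero.2 (hne g).1)) (abs_pos.2 (sub_ne_zero.2 (hne g).2)))
    (lt_min one_pos hL)
  have hε1' := hε1.trans_le (min_le_left _ _)
  have hεL := hε1.trans_le (min_le_right _ _)
  -- No endpoint of the window lies within ε of d + `q g` for the relevant g, so the patch of S of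
  -- radius R around `p w` does not depend on w.
  have key : ∀ w g, |q w - d| < ε → |p g| ≤ R →
      (p (w + g) ∈ S.vertexSet ↔ a < d + q g ∧ d + q g < b) := by
    intro w g hw hg
    have hw := _root_.abs_lt.1 hw
    by_cases hqg : |q g| ≤ Q
    · have h1 := hε g ⟨hg, hqg⟩
      have ha := h1.trans_le (min_le_left _ _)
      have hb := h1.trans_le (min_le_right _ _)
      rw [lt_abs] at ha hb
      constructor
      · intro h
        have h2 := hab _ h
        rw [map_add] at h2
        constructor
        · rcases ha with h | h <;> linarith [h2.1]
        · rcases hb with h | h <;> linarith [h2.2]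
      · rintro ⟨h2, h3⟩
        refine hab' _ ?_ ?_ <;> rw [map_add]
        · rcases ha with h | h <;> linarith
        · rcases hb with h | h <;> linarith
    · have hQ' := not_le.1 hqg
      have d1 := abs_le.1 (le_refl |d|)
      have a1 := abs_le.1 (le_refl |a|)
      have b1 := abs_le.1 (le_refl |b|)
      have a0 := abs_nonneg a
      have b0 := abs_nonneg b
      constructor
      · intro h
        have h2 := hab _ h
        rw [map_add] at h2
        rw [lt_abs] at hQ'
        rcases hQ' with h | h <;> linarith [h2.1, h2.2]
      · rintro ⟨h2, h3⟩
        rw [lt_abs] at hQ'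
        rcases hQ' with h | h <;> linarith
  have trans : ∀ w₁ w₂, |q w₁ - d| < ε → |q w₂ - d| < ε → q (φ w₁) ∈ Ω → q (φ w₂) ∈ Ω := by
    intro w₁ w₂ h₁ h₂ hΩ
    rw [← hTΩ, F.map_p] at hΩ ⊢
    have := him.vertex_transfer hr hD (x₀ := p w₁) (δ := p w₂ - p w₁) (fun x hx => ?_)
      (by rw [hσ]; exact hΩ)
    · rwa [hσ, add_sub_cancel] at this
    · constructor
      · intro hxS
        obtain ⟨y, rfl⟩ := hS hxS
        have k1 := key w₁ (y - w₁) h₁ (by rwa [map_sub])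
        have k2 := key w₂ (y - w₁) h₂ (by rwa [map_sub])
        rw [add_sub_cancel] at k1
        rw [show p y + (p w₂ - p w₁) = p (w₂ + (y - w₁)) by rw [map_add, map_sub]; ring]
        exact k2.2 (k1.1 hxS)
      · intro hxS
        obtain ⟨y, hy⟩ := hS hxS
        have hpx : p (y - w₂) = x - p w₁ := by rw [map_sub, hy]; ring
        have k1 := key w₁ (y - w₂) h₁ (by rwa [hpx])
        have k2 := key w₂ (y - w₂) h₂ (by rwa [hpx])
        rw [add_sub_cancel, hy] at k2
        rw [show x = p (w₁ + (y - w₂)) by rw [map_add, hpx]; ring]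
        exact k1.2 (k2.1 hxS)
  -- Points on the two sides of d are mapped by m to the two sides of c, where membership in Ω
  -- differs.
  obtain ⟨w₁, h₁, h₁'⟩ := F.exists_q_mem_Ioo (show d - ε < d by linarith)
  obtain ⟨w₂, h₂, h₂'⟩ := F.exists_q_mem_Ioo (show d < d + ε by linarith)
  have n₁ : |q w₁ - d| < ε := _root_.abs_lt.2 ⟨by linarith, by linarith⟩
  have n₂ : |q w₂ - d| < ε := _root_.abs_lt.2 ⟨by linarith, by linarith⟩
  have hml := _root_.abs_lt.1 F.abs_lt
  have hiff : q (φ w₁) ∈ Ω ↔ q (φ w₂) ∈ Ω := ⟨trans _ _ n₁ n₂, trans _ _ n₂ n₁⟩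
  rw [F.map_q, F.map_q] at hiff
  have small : ∀ w, |q w - d| < ε → |m * q w - c| < L := by
    intro w hw
    rw [hcd, ← mul_sub, abs_mul]
    exact (mul_le_of_le_one_left (abs_nonneg _) F.abs_lt.le).trans_lt (hw.trans hεL)
  have s₁ := _root_.abs_lt.1 (small _ n₁)
  have s₂ := _root_.abs_lt.1 (small _ n₂)
  rcases lt_or_gt_of_ne hm with hm | hm
  · have u₁ := mul_lt_mul_of_neg_left h₁' hm
    have u₂ := mul_lt_mul_of_neg_left h₂ hm
    rw [← hcd] at u₁ u₂
    exact hc _ _ (by linarith) u₂ u₁ (by linarith) hiff.symm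
  · have u₁ := mul_lt_mul_of_pos_left h₁' hm
    have u₂ := mul_lt_mul_of_pos_left h₂ hm
    rw [← hcd] at u₁ u₂
    exact hc _ _ (by linarith) u₁ u₂ (by linarith) hiff

theorem exists_of_isLocal (F : LatticeFrame p q φ l m) {σ : SubstitutionRule P}
    (hσ : σ.infl = l) {Ω : Set ℝ} {L : ℝ} (hΩ : IsWindow Ω L)
    (hT : T.vertexSet = {x | ∃ g, q g ∈ Ω ∧ x = p g}) (hsub : T.IsSubstitutionTiling σ)
    (hloc : T.IsLocal) : ∃ g, q g = (1 - m) * L ∨ q g = (1 + m) * L := by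
  obtain ⟨hL, t, ht⟩ := hΩ
  obtain ⟨r, hr⟩ := hloc
  obtain ⟨S, hST, him⟩ := hsub 1
  have him := him.isImage
  have hrS : S.IsLocalWith r := IsLocalWith.of_patchesIn hr hST.1
  have hTr : T.vertexSet ⊆ Set.range p := by
    rw [hT]
    rintro _ ⟨g, -, rfl⟩
    exact ⟨g, rfl⟩
  have hTΩ : ∀ g, p g ∈ T.vertexSet ↔ q g ∈ Ω := fun g => by
    rw [hT]
    exact ⟨fun ⟨g', h, e⟩ => F.p_injective e ▸ h, fun h => ⟨g, h, rfl⟩⟩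
  have hSr : S.vertexSet ⊆ Set.range p := by
    rintro _ ⟨i, rfl⟩
    obtain ⟨k, hk⟩ := him
    obtain ⟨g, hg⟩ := hTr ⟨k i, rfl⟩
    refine ⟨φ.symm g, ?_⟩
    rw [F.map_p_symm, hg, (hk i).2.1, hσ]
    exact mul_div_cancel_left₀ _ F.pos.ne'
  have hΩ₁ : Set.Ioo t (t + L) ⊆ Ω := by
    rcases ht with rfl | rfl
    exacts [Set.Ioo_subset_Ico_self, Set.Ioo_subset_Ioc_self]
  have hΩ₂ : Ω ⊆ Set.Icc t (t + L) := by
    rcases ht with rfl | rfl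
    exacts [Set.Ico_subset_Icc_self, Set.Ioc_subset_Icc_self]
  have hΩ₃ : Ω.OrdConnected := by
    rcases ht with rfl | rfl
    exacts [Set.ordConnected_Ico, Set.ordConnected_Ioc]
  obtain ⟨a, b, hba, hab, hab'⟩ := F.exists_window hST hSr hTr hL hTΩ hΩ₁ hΩ₂ hΩ₃
  obtain ⟨u₁, h₁⟩ := F.exists_endpoint_eq hσ him hrS hSr hTΩ hab hab' (c := t) hL
    fun x y _ h2 h3 h4 h => by linarith [(hΩ₂ (h.2 (hΩ₁ ⟨h3, h4⟩))).1]
  obtain ⟨u₂, h₂⟩ := F.exists_endpoint_eq hσ him hrS hSr hTΩ hab hab' (c := t + L) hL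
    fun x y h1 h2 h3 _ h => by linarith [(hΩ₂ (h.1 (hΩ₁ ⟨by linarith, h2⟩))).2]
  have hb : b = a + L := by linarith
  subst hb
  -- If both endpoints of Ω correspond to the same endpoint, L itself is a lattice value; this is
  -- absorbed into the factor 1 - m.
  have hLm : ∀ g, q g = L → q (g - φ g) = (1 - m) * L := fun g hg => by
    rw [map_sub, F.map_q, hg]; ring
  rcases h₁ with h₁ | h₁ <;> rcases h₂ with h₂ | h₂
  · exact ⟨_, Or.inl (hLm (u₁ - u₂) (by rw [map_sub]; linarith))⟩
  · exact ⟨u₁ - u₂, Or.inl (by rw [map_sub]; linarith)⟩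
  · exact ⟨u₁ - u₂, Or.inr (by rw [map_sub]; linarith)⟩
  · exact ⟨_, Or.inl (hLm (u₁ - u₂) (by rw [map_sub]; linarith))⟩

end LatticeFrame

/-! ### Nonlocality for a general matrix -/

theorem IsEigenFrame.onlyNonlocal {M : Matrix (Fin 2) (Fin 2) ℤ} {lam mu : ℝ} {v w : Fin 2 → ℝ}
    (h : IsEigenFrame M lam mu v w) {L : ℝ} {Ω : Set ℝ} (hΩ : IsWindow Ω L)
    (hL : L ∉ quotSet (latticeProj v) ((M.det : ℝ) + lam) ∪
      quotSet (latticeProj v) ((M.det : ℝ) - lam)) :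
    OnlyNonlocal (projectionTiling v w Ω) |lam| := by
  intro A _ P σ T hσ hT hsub hloc
  obtain ⟨φ, m, F, hm⟩ := h.exists_latticeFrame
  obtain ⟨g, hg⟩ := F.exists_of_isLocal hσ hΩ hT hsub hloc
  have key : ∃ g, latticeProjY v g = (1 - mu) * L ∨ latticeProjY v g = (1 + mu) * L := by
    rcases hm with rfl | rfl
    · exact ⟨g, hg⟩
    · exact ⟨g, by simpa [sub_eq_add_neg, or_comm] using hg⟩
  obtain ⟨g, hg⟩ := key
  have hd := h.abs_det
  have h1 := h.expanding
  have hlm := h.lam_mul_mu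
  -- Since λ = det M / μ with det M = ±1, multiplication by λ on the values of `q` is realised by
  -- φ⁻¹ up to sign.
  have hq : ∃ g', latticeProjY v g' = lam * latticeProjY v g := by
    have e := F.map_q_symm g
    have hmu := h.mu_ne
    rcases (abs_eq zero_le_one).1 hd with hd | hd <;> rw [hd] at hlm <;>
      rcases hm with rfl | rfl
    · exact ⟨φ.symm g, by rw [e]; field_simp; linear_combination -latticeProjY v g * hlm⟩
    · exact ⟨-φ.symm g, by
        rw [map_neg, e]; field_simp; linear_combination -latticeProjY v g * hlm⟩
    · exact ⟨-φ.symm g, by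
        rw [map_neg, e]; field_simp; linear_combination -latticeProjY v g * hlm⟩
    · exact ⟨φ.symm g, by rw [e]; field_simp; linear_combination -latticeProjY v g * hlm⟩
  obtain ⟨g', hg'⟩ := hq
  have hne : ∀ s : ℝ, |s| = |lam| → (M.det : ℝ) + s ≠ 0 := fun s hs h0 => by
    rw [← hs, eq_neg_of_add_eq_zero_right h0, abs_neg, hd] at h1
    exact h1.false
  apply hL
  rcases hg with hg | hg
  · refine Or.inr ⟨_, ⟨-g', rfl⟩, ?_⟩
    change L = latticeProjY v (-g') / _
    rw [eq_div_iff (by rw [sub_eq_add_neg]; exact hne _ (abs_neg _)), map_neg, hg', hg]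
    linear_combination -L * hlm
  · refine Or.inl ⟨_, ⟨g', rfl⟩, ?_⟩
    change L = latticeProjY v g' / _
    rw [eq_div_iff (hne _ rfl), hg', hg]
    linear_combination -L * hlm

/-- A locally finite set of reals without largest or smallest element has the order type of ℤ. -/
theorem exists_strictMono_int_range_eq {X : Set ℝ} (hne : X.Nonempty)
    (hmax : ∀ x ∈ X, ∃ y ∈ X, x < y) (hmin : ∀ x ∈ X, ∃ y ∈ X, y < x)
    (hfin : ∀ a b, (X ∩ Set.Icc a b).Finite) :
    ∃ f : ℤ → ℝ, StrictMono f ∧ Set.range f = X := by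
  classical
  have : Nonempty X := hne.to_subtype
  have : NoMaxOrder X := ⟨fun x => by
    obtain ⟨y, hy, h⟩ := hmax x x.2
    exact ⟨⟨y, hy⟩, h⟩⟩
  have : NoMinOrder X := ⟨fun x => by
    obtain ⟨y, hy, h⟩ := hmin x x.2
    exact ⟨⟨y, hy⟩, h⟩⟩
  let _ : LocallyFiniteOrder X := LocallyFiniteOrder.ofFiniteIcc fun a b => by
    refine Set.Finite.of_finite_image ((hfin a b).subset ?_) Subtype.val_injective.injOn
    rintro _ ⟨x, hx, rfl⟩
    exact ⟨x.2, hx.1, hx.2⟩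
  let _ : SuccOrder X := LinearLocallyFiniteOrder.succOrder X
  let _ : PredOrder X := LinearLocallyFiniteOrder.predOrder X
  let f := (orderIsoIntOfLinearSuccPredArch (ι := X)).symm
  refine ⟨fun i => f i, fun i j h => f.strictMono h, ?_⟩
  ext x
  exact ⟨fun ⟨i, hi⟩ => hi ▸ (f i).2, fun hx => ⟨f.symm ⟨x, hx⟩, by simp⟩⟩

/-! ### Cuts of a lattice and the tilings they define -/

section Cut

variable {G : Type} [AddCommGroup G]

/-- A proper nonempty subset of `G` that is closed upwards with respect to `q`. -/
structure IsCut (q : G →+ ℝ) (U : Set G) : Prop where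
  up : ∀ g ∈ U, ∀ h, q g ≤ q h → h ∈ U
  nonempty : U.Nonempty
  compl_nonempty : Uᶜ.Nonempty

def cutShift (U : Set G) (g : G) : Set G := {y | y + g ∈ U}

/-- The points `x` such that `n • x` lies in the window above the cut `U` of length `e`. -/
def cutVertices (n : ℕ) (e : G) (U : Set G) : Set G := {x | n • x ∈ U ∧ n • x - e ∉ U}

/-- For a pointed cut, -β can be undecided only in this range of `q β`: points with nonnegative `q`
belong to the cut, and those with `q` at most -`q e` do not. -/
def cutBoundary (p q : G →+ ℝ) (e : G) (K : ℝ) : Set G :=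
  {β | |p β| ≤ K ∧ 0 ≤ q β ∧ q β ≤ q e}

/-- The position of the cut relative to the finitely many points `-β`. -/
def cutLabel (p q : G →+ ℝ) (e : G) (K : ℝ) (U : Set G) : Set G :=
  {β | β ∈ cutBoundary p q e K ∧ -β ∈ U}

/-- A cut for which `0` is a vertex. -/
structure IsPointedCut (q : G →+ ℝ) (e : G) (C : Set G) : Prop extends IsCut q C where
  zero_mem : (0 : G) ∈ C
  neg_notMem : -e ∉ C

/-- The cut which defines the inflated vertices among its vertices. -/
def cutInflate (φ : G ≃+ G) (e : G) (C : Set G) : Set G := {z | φ.symm (z + e) ∉ C}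

def cutDeflate (φ : G ≃+ G) (e : G) (U : Set G) : Set G := {y | φ y - e ∉ U}

/-- Restricting to realised labels lets a representative cut be chosen for each label. -/
def CutLabel (p q : G →+ ℝ) (e : G) (K : ℝ) : Type :=
  {a : Set G // ∃ C, IsPointedCut q e C ∧ cutLabel p q e K C = a}

/-- `d` is the vertex next to `0`. -/
def IsNextVertex (p : G →+ ℝ) (n : ℕ) (e : G) (C : Set G) (d : G) : Prop :=
  d ∈ cutVertices n e C ∧ 0 < p d ∧ ∀ d' ∈ cutVertices n e C, 0 < p d' → p d ≤ p d'

variable {p q : G →+ ℝ} {φ : G ≃+ G} {l m D K : ℝ} {n : ℕ} {e : G} {U C C₁ C₂ : Set G}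

theorem cutInflate_cutDeflate (φ : G ≃+ G) (e : G) (U : Set G) :
    cutInflate φ e (cutDeflate φ e U) = U := by
  ext z
  simp [cutInflate, cutDeflate]

theorem cutShift_cutShift (U : Set G) (g h : G) :
    cutShift (cutShift U g) h = cutShift U (g + h) := by
  ext y
  simp only [cutShift, Set.mem_ofPred_eq, add_assoc, add_comm h g]

theorem cutShift_cutInflate (φ : G ≃+ G) (e : G) (C : Set G) (g : G) :
    cutShift (cutInflate φ e C) (φ g) = cutInflate φ e (cutShift C g) := by
  ext y
  simp only [cutShift, cutInflate, Set.mem_ofPred_eq]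
  rw [show y + φ g + e = (y + e) + φ g by abel, map_add φ.symm (y + e), φ.symm_apply_apply]

theorem mem_cutVertices_cutShift {x d : G} :
    d ∈ cutVertices n e (cutShift U (n • x)) ↔ x + d ∈ cutVertices n e U := by
  simp only [cutVertices, cutShift, Set.mem_ofPred_eq, smul_add]
  rw [add_comm (n • d), show n • d - e + n • x = n • x + n • d - e by abel]

namespace IsCut

theorem exists_threshold (hU : IsCut q U) :
    ∃ s, (∀ g, s < q g → g ∈ U) ∧ ∀ g, q g < s → g ∉ U := by
  obtain ⟨h, hh⟩ := hU.compl_nonempty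
  have hb : BddBelow (q '' U) := ⟨q h, by
    rintro _ ⟨g, hg, rfl⟩
    by_contra hlt
    exact hh (hU.up g hg h (not_le.1 hlt).le)⟩
  refine ⟨sInf (q '' U), fun g hg => ?_, fun g hg hgU => ?_⟩
  · obtain ⟨_, ⟨u, hu, rfl⟩, hlt⟩ := exists_lt_of_csInf_lt (hU.nonempty.image q) hg
    exact hU.up u hu g hlt.le
  · exact (csInf_le hb ⟨g, hgU, rfl⟩).not_gt hg

theorem shift (hU : IsCut q U) (g : G) : IsCut q (cutShift U g) where
  up a ha b hab := hU.up _ ha _ (by rw [map_add, map_add]; linarith)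
  nonempty := by
    obtain ⟨u, hu⟩ := hU.nonempty
    exact ⟨u - g, by simpa [cutShift] using hu⟩
  compl_nonempty := by
    obtain ⟨u, hu⟩ := hU.compl_nonempty
    exact ⟨u - g, by simpa [cutShift] using hu⟩

theorem pointed_shift (hU : IsCut q U) {x : G} (hx : x ∈ cutVertices n e U) :
    IsPointedCut q e (cutShift U (n • x)) where
  toIsCut := hU.shift _
  zero_mem := by simpa [cutShift] using hx.1
  neg_notMem := by simpa [cutShift, neg_add_eq_sub] using hx.2

/-- The values of `q` at a finite set are separated by an interval, in the same way as the set is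
separated by the cut. -/
theorem exists_interval (hU : IsCut q U) {s : Set G} (hs : s.Finite) :
    ∃ a b : ℝ, a < b ∧ ∀ c, a < c → c < b → ∀ g ∈ s, (g ∈ U → c < q g) ∧ (g ∉ U → q g < c) := by
  obtain ⟨t, h₁, h₂⟩ := hU.exists_threshold
  obtain ⟨ε, hε, -, hs'⟩ := (hs.subset (Set.sep_subset s fun g => q g ≠ t)).exists_pos_lt
    (f := fun g => |q g - t|) (fun g hg => abs_pos.2 (sub_ne_zero.2 hg.2)) one_pos
  have key : ∀ g ∈ s, (g ∈ U → q g = t ∨ t + ε < q g) ∧ (g ∉ U → q g = t ∨ q g < t - ε) := by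
    intro g hg
    by_cases hgt : q g = t
    · exact ⟨fun _ => Or.inl hgt, fun _ => Or.inl hgt⟩
    have h3 := hs' g ⟨hg, hgt⟩
    rw [lt_abs] at h3
    constructor
    · intro hgU
      have h4 : t ≤ q g := not_lt.1 fun h => h₂ g h hgU
      rcases h3 with h3 | h3
      · exact Or.inr (by linarith)
      · linarith
    · intro hgU
      have h4 : q g ≤ t := not_lt.1 fun h => hgU (h₁ g h)
      rcases h3 with h3 | h3
      · linarith
      · exact Or.inr (by linarith)
  -- If the threshold is attained, its points lie in the cut and nearby thresholds must be taken
  -- below t; otherwise they must be taken above.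
  by_cases hmin : ∃ u ∈ U, q u = t
  · obtain ⟨u, hu, hut⟩ := hmin
    refine ⟨t - ε, t, by linarith, fun c hc1 hc2 g hg => ⟨fun h => ?_, fun h => ?_⟩⟩
    · rcases (key g hg).1 h with h | h <;> linarith
    · rcases (key g hg).2 h with h' | h'
      · exact absurd (hU.up u hu g (by rw [hut, h'])) h
      · linarith
  · refine ⟨t, t + ε, by linarith, fun c hc1 hc2 g hg => ⟨fun h => ?_, fun h => ?_⟩⟩
    · rcases (key g hg).1 h with h' | h'
      · exact absurd ⟨g, h, h'⟩ hmin
      · linarith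
    · rcases (key g hg).2 h with h | h <;> linarith

end IsCut

/-- Bounds for the gaps between vertices and for the points that determine the labels. -/
structure CutFrame (p q : G →+ ℝ) (φ : G ≃+ G) (l m : ℝ) (n : ℕ) (e : G) (D K : ℝ) : Prop
    extends LatticeFrame p q φ l m where
  neg : m < 0
  n_pos : 0 < n
  e_pos : 0 < q e
  exists_vertex : ∀ U, IsCut q U → ∀ x ∈ cutVertices n e U,
    (∃ d, 0 < p d ∧ p d ≤ D ∧ x + d ∈ cutVertices n e U) ∧
    ∃ d, 0 < p d ∧ p d ≤ D ∧ x - d ∈ cutVertices n e U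
  bound_next : |p e| + n * D ≤ K
  bound_inflate : n * (l * D) + K + |p e| ≤ l * K

/-- As m < 0, two consecutive iterates of an element with positive `p` have small `q`-values of
opposite signs. -/
theorem LatticeFrame.exists_small (F : LatticeFrame p q φ l m) (hm : m < 0) {ε : ℝ} (hε : 0 < ε) :
    ∃ d₁ d₂, 0 < p d₁ ∧ 0 < p d₂ ∧ 0 < q d₁ ∧ q d₁ < ε ∧ q d₂ < 0 ∧ -ε < q d₂ := by
  obtain ⟨g, hg, hp⟩ : ∃ g : G, g ≠ 0 ∧ 0 < p g := by
    obtain ⟨g, hg⟩ := F.exists_ne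
    rcases lt_or_gt_of_ne fun h => hg (F.eq_zero_of_p h) with h | h
    · exact ⟨-g, neg_ne_zero.2 hg, by rw [map_neg]; linarith⟩
    · exact ⟨g, hg, h⟩
  obtain ⟨N, hN⟩ := F.exists_abs_q_lt g hε
  have a := _root_.abs_lt.1 (hN N le_rfl)
  have b := _root_.abs_lt.1 (hN (N + 1) (by omega))
  have hpos : ∀ k, 0 < p (φ^[k] g) := fun k => by
    rw [F.map_p_iter]; exact mul_pos (pow_pos F.pos _) hp
  have hne : q (φ^[N] g) ≠ 0 := by
    rw [F.map_q_iter]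
    exact mul_ne_zero (pow_ne_zero _ F.ne_zero) fun h => hg (F.eq_zero_of_q h)
  have hs : q (φ^[N + 1] g) = m * q (φ^[N] g) := by
    rw [Function.iterate_succ_apply', F.map_q]
  rcases lt_or_gt_of_ne hne with h | h
  · exact ⟨_, _, hpos (N + 1), hpos N, by rw [hs]; exact mul_pos_of_neg_of_neg hm h, b.2, h, a.1⟩
  · exact ⟨_, _, hpos N, hpos (N + 1), h, a.2, by rw [hs]; exact mul_neg_of_neg_of_pos hm h, b.1⟩

theorem LatticeFrame.exists_cutFrame (F : LatticeFrame p q φ l m) (hm : m < 0) (hn : 0 < n)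
    (he : 0 < q e) : ∃ D K, CutFrame p q φ l m n e D K := by
  have hn' : (0 : ℝ) < n := Nat.cast_pos.2 hn
  obtain ⟨d₁, d₂, p₁, p₂, q₁, q₁', q₂, q₂'⟩ :=
    F.exists_small hm (ε := q e / (2 * n)) (by positivity)
  rw [lt_div_iff₀ (by positivity)] at q₁'
  rw [← neg_div, div_lt_iff₀ (by positivity)] at q₂'
  have r₁ := mul_pos hn' q₁
  have r₂ := mul_neg_of_pos_of_neg hn' q₂
  have hmul : ∀ x : G, q (n • x) = n * q x := fun x => by rw [map_nsmul, nsmul_eq_mul]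
  set D := max (p d₁) (p d₂) with hD
  have hl := sub_pos.2 F.one_lt
  have hD0 : 0 < D := p₁.trans_le (le_max_left _ _)
  have hl0 := F.pos
  -- The last summand of K solves the linear inequality `bound_inflate`, which is possible because l
  -- > 1.
  refine ⟨D, |p e| + n * D + (n * (l * D) + |p e|) / (l - 1), F, hm, hn, he, fun U hU x hx =>
    ⟨?_, ?_⟩, ?_, ?_⟩
  -- If a step by `d₁` leaves the window at the top, the step by `d₂` stays inside: the two differ
  -- in n·`q` by less than the window length.
  · by_cases h : n • (x + d₁) - e ∈ U
    · refine ⟨d₂, p₂, le_max_right _ _, hU.up _ h _ ?_, fun h' => hx.2 (hU.up _ h' _ ?_)⟩ <;>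
      · simp only [map_sub, hmul, map_add]
        linarith
    · refine ⟨d₁, p₁, le_max_left _ _, hU.up _ hx.1 _ ?_, h⟩
      simp only [hmul, map_add]
      linarith
  · by_cases h : n • (x - d₁) ∈ U
    · refine ⟨d₁, p₁, le_max_left _ _, h, fun h' => hx.2 (hU.up _ h' _ ?_)⟩
      simp only [map_sub, hmul]
      linarith
    · refine ⟨d₂, p₂, le_max_right _ _, hU.up _ hx.1 _ ?_, fun h' => h (hU.up _ h' _ ?_)⟩ <;>
      · simp only [map_sub, hmul]
        linarith
  · have : 0 ≤ (n * (l * D) + |p e|) / (l - 1) := by positivity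
    linarith
  · have h1 : (l - 1) * ((n * (l * D) + |p e|) / (l - 1)) = n * (l * D) + |p e| := by
      field_simp
    have h2 : 0 ≤ (l - 1) * (|p e| + n * D) := by positivity
    linarith

end Cut

/-! ### Labelled tilings defined by cuts -/

namespace CutFrame

variable {G : Type} [AddCommGroup G] {p q : G →+ ℝ} {φ : G ≃+ G} {l m D K : ℝ} {n : ℕ} {e : G}
  {U U' C C₁ C₂ : Set G}

theorem exists_mem_cutVertices (F : CutFrame p q φ l m n e D K) (hU : IsCut q U) :
    ∃ x, x ∈ cutVertices n e U := by
  obtain ⟨s, h₁, h₂⟩ := hU.exists_threshold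
  have hn : (0 : ℝ) < n := Nat.cast_pos.2 F.n_pos
  obtain ⟨x, hx, hx'⟩ := F.exists_q_mem_Ioo (show s / n < (s + q e) / n by
    gcongr; linarith [F.e_pos])
  rw [div_lt_iff₀ hn] at hx
  rw [lt_div_iff₀ hn] at hx'
  refine ⟨x, h₁ _ ?_, h₂ _ ?_⟩ <;> simp only [map_sub, map_nsmul, nsmul_eq_mul] <;> linarith

theorem finite_cutVertices (F : CutFrame p q φ l m n e D K) (hU : IsCut q U) (R : ℝ) :
    {x | x ∈ cutVertices n e U ∧ |p x| ≤ R}.Finite := by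
  obtain ⟨s, h₁, h₂⟩ := hU.exists_threshold
  have hn : (1 : ℝ) ≤ n := Nat.one_le_cast.2 F.n_pos
  refine (F.finite (max R (|s| + q e))).subset ?_
  rintro x ⟨⟨hx, hx'⟩, hR⟩
  refine ⟨hR.trans (le_max_left _ _), le_trans ?_ (le_max_right _ _)⟩
  have k₁ : s ≤ n * q x := by
    have := not_lt.1 fun h => h₂ _ h hx
    rwa [map_nsmul, nsmul_eq_mul] at this
  have k₂ : n * q x ≤ s + q e := by
    have := not_lt.1 fun h => hx' (h₁ _ h)
    rw [map_sub, map_nsmul, nsmul_eq_mul] at this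
    linarith
  have k₃ : |q x| ≤ n * |q x| := le_mul_of_one_le_left (abs_nonneg _) hn
  have k₄ : n * |q x| = |n * q x| := by rw [abs_mul, Nat.abs_cast]
  have := abs_le.1 (le_refl |s|)
  have he := F.e_pos
  rw [k₄] at k₃
  refine k₃.trans (abs_le.2 ⟨?_, ?_⟩) <;> linarith

theorem finite_cutBoundary (F : CutFrame p q φ l m n e D K) : (cutBoundary p q e K).Finite := by
  refine (F.finite (max K (q e))).subset ?_
  rintro x ⟨h₁, h₂, h₃⟩
  exact ⟨h₁.trans (le_max_left _ _), by
    rw [abs_of_nonneg h₂]; exact h₃.trans (le_max_right _ _)⟩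

theorem finite_cutLabel (F : CutFrame p q φ l m n e D K) : Finite (CutLabel p q e K) := by
  have := F.finite_cutBoundary.finite_subsets.to_subtype
  refine Finite.of_injective (β := ↥{s | s ⊆ cutBoundary p q e K}) (fun a => ⟨a.1, ?_⟩) ?_
  · obtain ⟨C, -, hC⟩ := a.2
    rw [← hC]
    exact fun β hβ => hβ.1
  · intro a b h
    exact Subtype.ext (Subtype.mk.inj h)

/-- The vertices, in increasing order. -/
theorem exists_enumeration (F : CutFrame p q φ l m n e D K) (hU : IsCut q U) :
    ∃ x : ℤ → G, StrictMono (fun i => p (x i)) ∧ Set.range x = cutVertices n e U := by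
  have hmax : ∀ r ∈ p '' cutVertices n e U, ∃ r' ∈ p '' cutVertices n e U, r < r' := by
    rintro _ ⟨x, hx, rfl⟩
    obtain ⟨d, hd, -, hxd⟩ := (F.exists_vertex U hU x hx).1
    exact ⟨_, ⟨_, hxd, rfl⟩, by rw [map_add]; linarith⟩
  have hmin : ∀ r ∈ p '' cutVertices n e U, ∃ r' ∈ p '' cutVertices n e U, r' < r := by
    rintro _ ⟨x, hx, rfl⟩
    obtain ⟨d, hd, -, hxd⟩ := (F.exists_vertex U hU x hx).2
    exact ⟨_, ⟨_, hxd, rfl⟩, by rw [map_sub]; linarith⟩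
  have hfin : ∀ a b, (p '' cutVertices n e U ∩ Set.Icc a b).Finite := by
    intro a b
    refine ((F.finite_cutVertices hU (max |a| |b|)).image p).subset ?_
    rintro _ ⟨⟨x, hx, rfl⟩, h⟩
    exact ⟨x, ⟨hx, abs_le_max_abs_abs h.1 h.2⟩, rfl⟩
  obtain ⟨f, hf, hr⟩ := exists_strictMono_int_range_eq
    (Set.Nonempty.image p (F.exists_mem_cutVertices hU)) hmax hmin hfin
  have : ∀ i, ∃ x ∈ cutVertices n e U, p x = f i := fun i => by
    have : f i ∈ p '' cutVertices n e U := hr ▸ ⟨i, rfl⟩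
    exact this
  choose x hx hpx using this
  refine ⟨x, fun i j h => by simpa only [hpx] using hf h, ?_⟩
  ext y
  refine ⟨fun ⟨i, hi⟩ => hi ▸ hx i, fun hy => ?_⟩
  have : p y ∈ Set.range f := hr ▸ ⟨y, hy, rfl⟩
  obtain ⟨i, hi⟩ := this
  exact ⟨i, F.p_injective (by rw [hpx, hi])⟩

theorem exists_isNextVertex (F : CutFrame p q φ l m n e D K) (hC : IsPointedCut q e C) :
    ∃ d, IsNextVertex p n e C d := by
  have h0 : (0 : G) ∈ cutVertices n e C := by
    simpa [cutVertices] using ⟨hC.zero_mem, hC.neg_notMem⟩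
  obtain ⟨d, hd, hdD, hdC⟩ := (F.exists_vertex C hC.toIsCut 0 h0).1
  rw [zero_add] at hdC
  have hfin : {x | (x ∈ cutVertices n e C ∧ |p x| ≤ D) ∧ 0 < p x}.Finite :=
    (F.finite_cutVertices hC.toIsCut D).subset fun x hx => hx.1
  obtain ⟨x, ⟨⟨hx, hxD⟩, hx0⟩, hmin⟩ := Set.exists_min_image _ p hfin
    ⟨d, ⟨hdC, by rwa [abs_of_pos hd]⟩, hd⟩
  refine ⟨x, hx, hx0, fun y hy hy0 => ?_⟩
  rcases le_or_gt (p y) D with h | h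
  · exact hmin y ⟨⟨hy, by rwa [abs_of_pos hy0]⟩, hy0⟩
  · exact ((le_abs_self _).trans hxD).trans h.le

theorem isNextVertex_le (F : CutFrame p q φ l m n e D K) (hC : IsPointedCut q e C) {d : G}
    (hd : IsNextVertex p n e C d) : p d ≤ D := by
  have h0 : (0 : G) ∈ cutVertices n e C := by
    simpa [cutVertices] using ⟨hC.zero_mem, hC.neg_notMem⟩
  obtain ⟨d', hd', hdD', hdC'⟩ := (F.exists_vertex C hC.toIsCut 0 h0).1
  rw [zero_add] at hdC'
  exact (hd.2.2 d' hdC' hd').trans hdD'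

/-- Outside the strip recorded by the label, membership is forced by 0 ∈ C and -e ∉ C. -/
theorem mem_of_label_eq (h₁ : IsPointedCut q e C₁) (h₂ : IsPointedCut q e C₂)
    (h : cutLabel p q e K C₁ = cutLabel p q e K C₂) {g : G} (hg : |p g| ≤ K) (hC : g ∈ C₁) :
    g ∈ C₂ := by
  rcases le_or_gt 0 (q g) with h0 | h0
  · exact h₂.up 0 h₂.zero_mem g (by rwa [map_zero])
  · have hge : -q e ≤ q g := not_lt.1 fun hlt =>
      h₁.neg_notMem (h₁.up g hC _ (by rw [map_neg]; exact hlt.le))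
    have : -g ∈ cutLabel p q e K C₁ := ⟨⟨by rwa [map_neg, abs_neg], by rw [map_neg]; linarith,
      by rw [map_neg]; linarith⟩, by rwa [neg_neg]⟩
    rw [h] at this
    simpa using this.2

theorem mem_iff_of_label_eq (h₁ : IsPointedCut q e C₁) (h₂ : IsPointedCut q e C₂)
    (h : cutLabel p q e K C₁ = cutLabel p q e K C₂) {g : G} (hg : |p g| ≤ K) :
    g ∈ C₁ ↔ g ∈ C₂ :=
  ⟨mem_of_label_eq h₁ h₂ h hg, mem_of_label_eq h₂ h₁ h.symm hg⟩

theorem mem_cutVertices_of_label_eq (F : CutFrame p q φ l m n e D K) (h₁ : IsPointedCut q e C₁)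
    (h₂ : IsPointedCut q e C₂) (h : cutLabel p q e K C₁ = cutLabel p q e K C₂) {d : G}
    (hd : |p d| ≤ D) : d ∈ cutVertices n e C₁ ↔ d ∈ cutVertices n e C₂ := by
  have hb := F.bound_next
  have k : |p (n • d)| ≤ n * D := by
    rw [map_nsmul, nsmul_eq_mul, abs_mul, Nat.abs_cast]
    gcongr
  have k' : |p (n • d - e)| ≤ K := by
    rw [map_sub]
    exact (abs_sub _ _).trans (by linarith)
  have k'' : |p (n • d)| ≤ K := k.trans (by linarith [abs_nonneg (p e)])
  exact and_congr (mem_iff_of_label_eq h₁ h₂ h k'') (not_congr (mem_iff_of_label_eq h₁ h₂ h k'))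

/-- The label of a vertex determines the next vertex. -/
theorem isNextVertex_unique (F : CutFrame p q φ l m n e D K) (h₁ : IsPointedCut q e C₁)
    (h₂ : IsPointedCut q e C₂) (h : cutLabel p q e K C₁ = cutLabel p q e K C₂) {d₁ d₂ : G}
    (hd₁ : IsNextVertex p n e C₁ d₁) (hd₂ : IsNextVertex p n e C₂ d₂) : d₁ = d₂ := by
  have a₁ : |p d₁| ≤ D := by rw [abs_of_pos hd₁.2.1]; exact F.isNextVertex_le h₁ hd₁
  have a₂ : |p d₂| ≤ D := by rw [abs_of_pos hd₂.2.1]; exact F.isNextVertex_le h₂ hd₂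
  refine F.p_injective (le_antisymm ?_ ?_)
  · exact hd₁.2.2 _ ((F.mem_cutVertices_of_label_eq h₁ h₂ h a₂).2 hd₂.1) hd₂.2.1
  · exact hd₂.2.2 _ ((F.mem_cutVertices_of_label_eq h₁ h₂ h a₁).1 hd₁.1) hd₁.2.1

/-- A cut with a given label. -/
noncomputable def rep (a : CutLabel p q e K) : Set G := Classical.choose a.2

theorem rep_isPointedCut (a : CutLabel p q e K) : IsPointedCut q e (rep a) :=
  (Classical.choose_spec a.2).1

theorem cutLabel_rep (a : CutLabel p q e K) : cutLabel p q e K (rep a) = a.1 :=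
  (Classical.choose_spec a.2).2

/-- The difference of the endpoints of a tile with a given label. -/
noncomputable def step (F : CutFrame p q φ l m n e D K) (a : CutLabel p q e K) : G :=
  Classical.choose (F.exists_isNextVertex (rep_isPointedCut a))

theorem step_spec (F : CutFrame p q φ l m n e D K) (a : CutLabel p q e K) :
    IsNextVertex p n e (rep a) (F.step a) :=
  Classical.choose_spec (F.exists_isNextVertex (rep_isPointedCut a))

/-- The prototiles. -/
noncomputable def protoset (F : CutFrame p q φ l m n e D K) : Protoset (CutLabel p q e K) where
  len a := p (F.step a)
  len_pos a := (F.step_spec a).2.1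

/-- `T` is the tiling defined by the cut `U`, with the vertices enumerated by `x`. -/
structure IsCutTiling (F : CutFrame p q φ l m n e D K) (U : Set G) (x : ℤ → G)
    (T : LabelledTiling F.protoset) : Prop where
  isCut : IsCut q U
  vert_eq : ∀ i, T.vert i = p (x i)
  range_eq : Set.range x = cutVertices n e U
  label_eq : ∀ i, (T.label i).1 = cutLabel p q e K (cutShift U (n • x i))

/-- The tile length attached to a label is computed from a representative cut; it fits here because
the label determines the next vertex. -/
theorem exists_isCutTiling (F : CutFrame p q φ l m n e D K) (hU : IsCut q U) :
    ∃ x T, F.IsCutTiling U x T := by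
  obtain ⟨x, hx, hr⟩ := F.exists_enumeration hU
  have hmem : ∀ i, x i ∈ cutVertices n e U := fun i => hr ▸ ⟨i, rfl⟩
  have hpt : ∀ i, IsPointedCut q e (cutShift U (n • x i)) := fun i => hU.pointed_shift (hmem i)
  have hnext : ∀ i, IsNextVertex p n e (cutShift U (n • x i)) (x (i + 1) - x i) := by
    refine fun i => ⟨?_, ?_, fun d hd hd0 => ?_⟩
    · rw [mem_cutVertices_cutShift, add_sub_cancel]
      exact hmem _
    · rw [map_sub, sub_pos]
      exact hx (lt_add_one i)
    · rw [mem_cutVertices_cutShift, ← hr] at hd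
      obtain ⟨j, hj⟩ := hd
      have hij : i < j := hx.lt_iff_lt.1 (by
        change p (x i) < p (x j)
        rw [hj, map_add]; linarith)
      have : p (x (i + 1)) ≤ p (x j) := hx.monotone hij
      rw [hj, map_add] at this
      rw [map_sub]
      linarith
  let lab : ℤ → CutLabel p q e K := fun i =>
    ⟨cutLabel p q e K (cutShift U (n • x i)), _, hpt i, rfl⟩
  refine ⟨x, ⟨fun i => p (x i), lab, fun i => ?_⟩, hU, fun i => rfl, hr, fun i => rfl⟩
  have := F.isNextVertex_unique (hpt i) (rep_isPointedCut (lab i)) (cutLabel_rep (lab i)).symm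
    (hnext i) (F.step_spec _)
  change p (x (i + 1)) = p (x i) + p (F.step (lab i))
  rw [← this, map_sub, add_sub_cancel]

namespace IsCutTiling

variable {F : CutFrame p q φ l m n e D K} {x x' : ℤ → G} {T T' S : LabelledTiling F.protoset}

theorem succ (h : F.IsCutTiling U x T) (i : ℤ) : x (i + 1) = x i + F.step (T.label i) := by
  refine F.p_injective ?_
  rw [← h.vert_eq, T.vert_succ, map_add, h.vert_eq]
  rfl

theorem mem (h : F.IsCutTiling U x T) (i : ℤ) : x i ∈ cutVertices n e U := h.range_eq ▸ ⟨i, rfl⟩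

theorem pointed (h : F.IsCutTiling U x T) (i : ℤ) : IsPointedCut q e (cutShift U (n • x i)) :=
  h.isCut.pointed_shift (h.mem i)

theorem injective (h : F.IsCutTiling U x T) : Function.Injective x := fun i j hij =>
  T.vert_strictMono.injective (by rw [h.vert_eq, h.vert_eq, hij])

theorem vertexSet_eq (h : F.IsCutTiling U x T) : T.vertexSet = p '' cutVertices n e U := by
  rw [← h.range_eq, ← Set.range_comp]
  exact congrArg Set.range (funext h.vert_eq)

/-- A finite patch is determined by the side of the cut on which finitely many points lie. This
persists for an open interval of thresholds, and density of `q` provides a lattice translation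
bringing the other cut into that interval. -/
theorem patchesIn (h : F.IsCutTiling U x T) (h' : F.IsCutTiling U' x' T') :
    T.PatchesIn T' := by
  intro i N
  -- The boundary points carry the labels; 0 and e are added so that being a vertex is transferred
  -- too.
  have hfin : (⋃ k ∈ Set.Icc i (i + N), (fun β => -β + n • x k) ''
      (cutBoundary p q e K ∪ {0, e})).Finite :=
    (Set.finite_Icc _ _).biUnion fun k _ =>
      (F.finite_cutBoundary.union (Set.toFinite _)).image _
  obtain ⟨a, b, hab, hsep⟩ := h.isCut.exists_interval hfin
  obtain ⟨s', k₁, k₂⟩ := h'.isCut.exists_threshold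
  have hn : (0 : ℝ) < n := Nat.cast_pos.2 F.n_pos
  obtain ⟨s, hs₁, hs₂⟩ := F.exists_q_mem_Ioo (show (s' - b) / n < (s' - a) / n by gcongr)
  rw [div_lt_iff₀ hn] at hs₁
  rw [lt_div_iff₀ hn] at hs₂
  have key : ∀ k : ℕ, k ≤ N → ∀ β ∈ cutBoundary p q e K ∪ {0, e},
      (-β + n • x (i + k) ∈ U ↔ -β + n • (x (i + k) + s) ∈ U') := by
    intro k hk β hβ
    have := hsep (s' - n * q s) (by linarith) (by linarith) (-β + n • x (i + k))
      (Set.mem_biUnion (x := i + k) ⟨by omega, by omega⟩ ⟨β, hβ, rfl⟩)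
    have hq : q (-β + n • (x (i + k) + s)) = q (-β + n • x (i + k)) + n * q s := by
      simp only [map_add, map_nsmul, smul_add, nsmul_eq_mul, add_assoc]
    constructor
    · intro hU
      exact k₁ _ (by rw [hq]; linarith [this.1 hU])
    · intro hU'
      by_contra hU
      exact k₂ _ (by rw [hq]; linarith [this.2 hU]) hU'
  have hlab : ∀ k : ℕ, k ≤ N → ∀ j, x' j = x (i + k) + s → T'.label j = T.label (i + k) := by
    intro k hk j hj
    refine Subtype.ext ?_
    rw [h.label_eq, h'.label_eq, hj]
    ext β
    refine and_congr_right fun hβ => ?_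
    exact (key k hk β (Or.inl hβ)).symm
  obtain ⟨j, hj⟩ : ∃ j, x' j = x i + s := by
    have hmem : x i + s ∈ cutVertices n e U' := by
      have h₀ := key 0 (Nat.zero_le _) 0 (by simp)
      have h₁ := key 0 (Nat.zero_le _) e (by simp)
      rw [Nat.cast_zero, add_zero, neg_zero, zero_add, zero_add] at h₀
      rw [Nat.cast_zero, add_zero, neg_add_eq_sub, neg_add_eq_sub] at h₁
      exact ⟨h₀.1 (h.mem i).1, fun hc => (h.mem i).2 (h₁.2 hc)⟩
    rw [← h'.range_eq] at hmem
    exact hmem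
  -- Equal positions give equal labels, and equal labels give equal steps to the next position.
  have main : ∀ k : ℕ, k ≤ N → x' (j + k) = x (i + k) + s := by
    intro k
    induction k with
    | zero => intro _; simpa using hj
    | succ k ih =>
      intro hk
      have hk' := ih (by omega)
      push_cast
      rw [← add_assoc, ← add_assoc, h'.succ, h.succ, hlab k (by omega) _ hk', hk']
      abel
  exact ⟨j, fun k hk => hlab k hk.le _ (main k hk.le)⟩

end IsCutTiling

/-! ### Inflation -/

/-- Taking the complement undoes the order reversal caused by m < 0. -/
theorem isCut_cutInflate (F : CutFrame p q φ l m n e D K) (hC : IsCut q C) :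
    IsCut q (cutInflate φ e C) where
  up g hg h hgh hh := hg (hC.up _ hh _ (by
    rw [F.map_q_symm, F.map_q_symm, map_add, map_add]
    exact div_le_div_of_nonpos_of_le F.neg.le (by linarith)))
  nonempty := by
    obtain ⟨u, hu⟩ := hC.compl_nonempty
    exact ⟨φ u - e, by simpa [cutInflate] using hu⟩
  compl_nonempty := by
    obtain ⟨u, hu⟩ := hC.nonempty
    exact ⟨φ u - e, by simpa [cutInflate] using hu⟩

theorem isCut_cutDeflate (F : CutFrame p q φ l m n e D K) (hU : IsCut q U) :
    IsCut q (cutDeflate φ e U) where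
  up g hg h hgh hh := hg (hU.up _ hh _ (by
    rw [map_sub, map_sub, F.map_q, F.map_q]
    linarith [mul_le_mul_of_nonpos_left hgh F.neg.le]))
  nonempty := by
    obtain ⟨u, hu⟩ := hU.compl_nonempty
    exact ⟨φ.symm (u + e), by simpa [cutDeflate] using hu⟩
  compl_nonempty := by
    obtain ⟨u, hu⟩ := hU.nonempty
    exact ⟨φ.symm (u + e), by simpa [cutDeflate] using hu⟩

/-- A threshold s becomes ms - `q e`, so the new window has upper end ms. It contains the image of
the old window because |m| ≤ 1. -/
theorem map_mem_cutInflate (F : CutFrame p q φ l m n e D K) (hC : IsCut q C) {x : G}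
    (hx : x ∈ cutVertices n e C) : φ x ∈ cutVertices n e (cutInflate φ e C) := by
  constructor
  · intro h
    rw [map_add, map_nsmul, φ.symm_apply_apply] at h
    refine hx.2 (hC.up _ h _ ?_)
    rw [map_add, map_sub, F.map_q_symm, ← le_sub_iff_add_le', sub_sub_cancel_left,
      div_le_iff_of_neg F.neg]
    have := F.abs_lt.le
    rw [abs_of_neg F.neg] at this
    have := mul_le_mul_of_nonneg_right this F.e_pos.le
    linarith
  · intro h
    simp only [cutInflate, Set.mem_ofPred_eq, sub_add_cancel, map_nsmul, φ.symm_apply_apply] at h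
    exact h hx.1

/-- The points to be tested are pulled back by φ⁻¹, which divides `p` by l; `bound_inflate` says
that they fall within the radius K already recorded. -/
theorem cutLabel_cutInflate (F : CutFrame p q φ l m n e D K) (h₁ : IsPointedCut q e C₁)
    (h₂ : IsPointedCut q e C₂) (h : cutLabel p q e K C₁ = cutLabel p q e K C₂) {d : G}
    (hd : |p d| ≤ l * D) :
    cutLabel p q e K (cutShift (cutInflate φ e C₁) (n • d)) =
      cutLabel p q e K (cutShift (cutInflate φ e C₂) (n • d)) := by
  ext β
  refine and_congr_right fun hβ => not_congr (mem_iff_of_label_eq h₁ h₂ h ?_)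
  rw [F.map_p_symm, abs_div, abs_of_pos F.pos, div_le_iff₀ F.pos, map_add, map_add, map_neg,
    map_nsmul, nsmul_eq_mul]
  have h1 : |n * p d| ≤ n * (l * D) := by
    rw [abs_mul, Nat.abs_cast]
    gcongr
  have h2 := (abs_add_le (-p β + n * p d) (p e)).trans
    (add_le_add_left (abs_add_le (-p β) (n * p d)) _)
  rw [abs_neg] at h2
  linarith [hβ.1, F.bound_inflate]

/-- The tiles `f 0, …, f (N - 1)` cover the inflated tile `a`. -/
def IsInflatedPatch (F : CutFrame p q φ l m n e D K) (a : CutLabel p q e K)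
    (w : ℕ × (ℕ → CutLabel p q e K)) : Prop :=
  ∑ i ∈ Finset.range w.1, F.step (w.2 i) = φ (F.step a) ∧
    ∀ j < w.1, (w.2 j).1 = cutLabel p q e K
      (cutShift (cutInflate φ e (rep a)) (n • ∑ i ∈ Finset.range j, F.step (w.2 i)))

/-- The patch is read off the tiling of the inflated representative cut, between its vertices 0 and
φ(`F.step a`). -/
theorem exists_isInflatedPatch (F : CutFrame p q φ l m n e D K) (a : CutLabel p q e K) :
    ∃ w, F.IsInflatedPatch a w := by
  have hC := rep_isPointedCut a
  have h0 : (0 : G) ∈ cutVertices n e (rep a) := by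
    simpa [cutVertices] using ⟨hC.zero_mem, hC.neg_notMem⟩
  have h1 := (F.step_spec a).1
  obtain ⟨x, T, hT⟩ := F.exists_isCutTiling (F.isCut_cutInflate hC.toIsCut)
  have h0' := F.map_mem_cutInflate hC.toIsCut h0
  have h1' := F.map_mem_cutInflate hC.toIsCut h1
  rw [← hT.range_eq] at h0' h1'
  obtain ⟨i, hi⟩ := h0'
  obtain ⟨j, hj⟩ := h1'
  rw [map_zero] at hi
  have hsum : ∀ k : ℕ, ∑ r ∈ Finset.range k, F.step (T.label (i + r)) = x (i + k) := by
    intro k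
    induction k with
    | zero => simp [hi]
    | succ k ih =>
      rw [Finset.sum_range_succ, ih]
      push_cast
      rw [← add_assoc, hT.succ]
  have hij : i ≤ j := T.vert_strictMono.le_iff_le.1 (by
    rw [hT.vert_eq, hT.vert_eq, hi, hj, map_zero, F.map_p]
    exact mul_nonneg F.pos.le (F.step_spec a).2.1.le)
  refine ⟨⟨(j - i).toNat, fun r => T.label (i + r)⟩, ?_, fun k _ => ?_⟩
  · rw [hsum, show i + ((j - i).toNat : ℤ) = j by omega, hj]
  · rw [hsum, hT.label_eq]

noncomputable def inflatedPatch (F : CutFrame p q φ l m n e D K) (a : CutLabel p q e K) :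
    ℕ × (ℕ → CutLabel p q e K) :=
  Classical.choose (F.exists_isInflatedPatch a)

theorem inflatedPatch_spec (F : CutFrame p q φ l m n e D K) (a : CutLabel p q e K) :
    F.IsInflatedPatch a (F.inflatedPatch a) :=
  Classical.choose_spec (F.exists_isInflatedPatch a)

/-- The substitution rule. -/
noncomputable def rule (F : CutFrame p q φ l m n e D K) : SubstitutionRule F.protoset where
  infl := l
  one_lt_infl := F.one_lt
  repl a := (List.range (F.inflatedPatch a).1).map (F.inflatedPatch a).2
  covers a := by
    rw [List.map_map]
    change ∑ i ∈ Finset.range (F.inflatedPatch a).1, p (F.step ((F.inflatedPatch a).2 i)) =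
      l * p (F.step a)
    rw [← map_sum, (F.inflatedPatch_spec a).1, F.map_p]

theorem isImage_rule (F : CutFrame p q φ l m n e D K) {x y : ℤ → G}
    {S T : LabelledTiling F.protoset} (hS : F.IsCutTiling C x S)
    (hT : F.IsCutTiling (cutInflate φ e C) y T) : LabelledTiling.IsImage F.rule S T := by
  have hex : ∀ i, ∃ k, y k = φ (x i) := fun i => by
    have := F.map_mem_cutInflate hS.isCut (hS.mem i)
    rw [← hT.range_eq] at this
    exact this
  choose k hk using hex
  have key : ∀ i, ∀ j < (F.inflatedPatch (S.label i)).1,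
      y (k i + j) = φ (x i) + ∑ r ∈ Finset.range j, F.step ((F.inflatedPatch (S.label i)).2 r) →
      T.label (k i + j) = (F.inflatedPatch (S.label i)).2 j := by
    intro i j hj hy
    set a := S.label i with ha
    obtain ⟨s₁, s₂⟩ := F.inflatedPatch_spec a
    refine Subtype.ext ?_
    -- Inflation commutes with shifting, so the actual cut seen from `x i` can be compared with the
    -- representative having the same label.
    rw [s₂ j hj, hT.label_eq, hy, smul_add, ← cutShift_cutShift, ← map_nsmul, cutShift_cutInflate]
    refine F.cutLabel_cutInflate (hS.pointed i) (rep_isPointedCut a) ?_ ?_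
    · rw [cutLabel_rep, ha, hS.label_eq]
    · have hnn : ∀ r, 0 ≤ p (F.step ((F.inflatedPatch a).2 r)) := fun r =>
        (F.step_spec _).2.1.le
      rw [map_sum, abs_of_nonneg (Finset.sum_nonneg fun r _ => hnn r)]
      calc ∑ r ∈ Finset.range j, p (F.step ((F.inflatedPatch a).2 r))
          ≤ ∑ r ∈ Finset.range (F.inflatedPatch a).1, p (F.step ((F.inflatedPatch a).2 r)) :=
            Finset.sum_le_sum_of_subset_of_nonneg (Finset.range_mono hj.le) fun r _ _ => hnn r
        _ = l * p (F.step a) := by rw [← map_sum, s₁, F.map_p]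
        _ ≤ l * D := mul_le_mul_of_nonneg_left
            (F.isNextVertex_le (rep_isPointedCut a) (F.step_spec a)) F.pos.le
  have main : ∀ i, ∀ j ≤ (F.inflatedPatch (S.label i)).1,
      y (k i + j) = φ (x i) +
        ∑ r ∈ Finset.range j, F.step ((F.inflatedPatch (S.label i)).2 r) := by
    intro i j
    induction j with
    | zero => intro _; simp [hk]
    | succ j ih =>
      intro hj
      have hj' := ih (by omega)
      rw [Finset.sum_range_succ, ← key i j hj hj', ← add_assoc, ← hj', ← hT.succ]
      push_cast
      rw [add_assoc]
  have hlen : ∀ i, (F.rule.repl (S.label i)).length = (F.inflatedPatch (S.label i)).1 := fun i => by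
    simp [rule]
  refine ⟨k, fun i => ⟨?_, ?_, fun j => ?_⟩⟩
  · refine hT.injective ?_
    rw [hlen, main i _ le_rfl, (F.inflatedPatch_spec _).1, ← map_add, ← hS.succ, hk]
  · rw [hT.vert_eq, hk, F.map_p, hS.vert_eq]
    rfl
  · have hj : (j : ℕ) < (F.inflatedPatch (S.label i)).1 := hlen i ▸ j.2
    rw [key i j hj (main i j hj.le), List.get_eq_getElem]
    simp only [rule, List.getElem_map, List.getElem_range]

theorem exists_isIterImage (F : CutFrame p q φ l m n e D K) {y : ℤ → G}
    {T : LabelledTiling F.protoset} (hT : F.IsCutTiling U y T) (k : ℕ) :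
    ∃ C x S, F.IsCutTiling C x S ∧ LabelledTiling.IsIterImage F.rule k S T := by
  induction k with
  | zero => exact ⟨U, y, T, hT, 0, fun i => by simp⟩
  | succ k ih =>
    obtain ⟨C, x, R, hR, hRT⟩ := ih
    -- Deflating the cut inverts inflation exactly, so the earliest tiling found so far has a
    -- preimage again.
    obtain ⟨z, S, hS⟩ := F.exists_isCutTiling (F.isCut_cutDeflate hR.isCut)
    refine ⟨_, z, S, hS, R, F.isImage_rule hS (y := x) ?_, hRT⟩
    rwa [cutInflate_cutDeflate]

theorem admitsSubstitution (F : CutFrame p q φ l m n e D K) (hU : IsCut q U) :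
    AdmitsSubstitution (p '' cutVertices n e U) l := by
  obtain ⟨y, T, hT⟩ := F.exists_isCutTiling hU
  refine ⟨_, F.finite_cutLabel, F.protoset, F.rule, T, rfl, hT.vertexSet_eq, fun k => ?_⟩
  obtain ⟨C, x, S, hS, hST⟩ := F.exists_isIterImage hT k
  exact ⟨S, ⟨hS.patchesIn hT, hT.patchesIn hS⟩, hST⟩

end CutFrame

/-- If the automorphism reverses the contracting direction, then every window whose length is a
rational multiple of a lattice length gives a substitution tiling. -/
theorem LatticeFrame.admitsSubstitution {G : Type} [AddCommGroup G] {p q : G →+ ℝ} {φ : G ≃+ G}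
    {l m : ℝ} (F : LatticeFrame p q φ l m) (hm : m < 0) {n : ℕ} (hn : 0 < n) {e : G}
    (he : 0 < q e) {Ω : Set ℝ} (hΩ : IsWindow Ω (q e / n)) :
    AdmitsSubstitution {x | ∃ g, q g ∈ Ω ∧ x = p g} l := by
  obtain ⟨D, K, F'⟩ := F.exists_cutFrame hm hn he
  obtain ⟨-, t, ht⟩ := hΩ
  have hn' : (0 : ℝ) < n := Nat.cast_pos.2 hn
  obtain ⟨g₁, h₁, -⟩ := F.exists_q_mem_Ioo (lt_add_one (n * t))
  obtain ⟨g₀, -, h₀⟩ := F.exists_q_mem_Ioo (sub_one_lt (n * t))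
  -- The cut has threshold n·t, attained or not according to the side on which Ω is closed; shifting
  -- by e then gives the other endpoint with the complementary inclusion.
  obtain ⟨U, hU, hUΩ⟩ : ∃ U : Set G, IsCut q U ∧ ∀ g, g ∈ cutVertices n e U ↔ q g ∈ Ω := by
    rcases ht with rfl | rfl
    · refine ⟨{g | n * t ≤ q g}, ⟨fun g hg h hgh => le_trans hg hgh, ⟨g₁, h₁.le⟩,
        ⟨g₀, not_le.2 h₀⟩⟩, fun g => ?_⟩
      simp only [cutVertices, Set.mem_ofPred_eq, map_sub, map_nsmul, nsmul_eq_mul, not_le,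
        Set.mem_Ico]
      refine and_congr (mul_le_mul_iff_right₀ hn') ?_
      rw [sub_lt_iff_lt_add, ← mul_lt_mul_iff_right₀ hn' (c := t + q e / n), mul_add,
        mul_div_cancel₀ _ hn'.ne']
    · refine ⟨{g | n * t < q g}, ⟨fun g hg h hgh => lt_of_lt_of_le hg hgh, ⟨g₁, h₁⟩,
        ⟨g₀, not_lt.2 h₀.le⟩⟩, fun g => ?_⟩
      simp only [cutVertices, Set.mem_ofPred_eq, map_sub, map_nsmul, nsmul_eq_mul, not_lt,
        Set.mem_Ioc]
      refine and_congr (mul_lt_mul_iff_right₀ hn') ?_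
      rw [sub_le_iff_le_add, ← mul_le_mul_iff_right₀ hn' (c := t + q e / n), mul_add,
        mul_div_cancel₀ _ hn'.ne']
  have := F'.admitsSubstitution hU
  rwa [show p '' cutVertices n e U = {x | ∃ g, q g ∈ Ω ∧ x = p g} by
    ext x
    simp only [Set.mem_image, hUΩ, Set.mem_ofPred_eq, eq_comm]] at this

/-! ### The Fibonacci matrix -/

/-- Irrationality of τ leaves an integer equal to 1/n, which is impossible for n > 1. -/
theorem one_div_notMem_adjoin_goldenRatio {n : ℕ} (hn : 1 < n) :
    1 / (n : ℝ) ∉ (Algebra.adjoin ℤ {Real.goldenRatio} : Set ℝ) := by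
  rw [IsEigenFrame.coe_adjoin_int_eq Real.goldenRatio 1 1
    (by rw [← pow_two, Real.goldenRatio_sq]; push_cast; ring)]
  rintro ⟨a, b, hab⟩
  have hn0 : (n : ℝ) ≠ 0 := by positivity
  rw [div_eq_iff hn0] at hab
  have hb : b = 0 := by
    by_contra hb
    have hb' : ((b * n : ℤ) : ℝ) ≠ 0 := by
      exact_mod_cast mul_ne_zero hb (by omega)
    refine Real.goldenRatio_irrational ⟨((1 - a * n : ℤ) : ℚ) / ((b * n : ℤ) : ℚ), ?_⟩
    push_cast at hb' ⊢
    rw [div_eq_iff hb']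
    linear_combination hab
  rw [hb, Int.cast_zero, zero_mul, add_zero] at hab
  have h1 : a * n = 1 := by exact_mod_cast hab.symm
  have h2 := Int.isUnit_iff.1 (IsUnit.of_mul_eq_one_right a h1)
  omega

theorem det_fibMatrix : fibMatrix.det = -1 := by
  simp [fibMatrix, Matrix.det_fin_two]

theorem one_div_notMem_quotSet {n : ℕ} (hn : 1 < n) :
    (1 / (n : ℝ)) ∉
      quotSet (Algebra.adjoin ℤ {Real.goldenRatio} : Set ℝ)
        ((fibMatrix.det : ℝ) + Real.goldenRatio) ∪
      quotSet (Algebra.adjoin ℤ {Real.goldenRatio} : Set ℝ)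
        ((fibMatrix.det : ℝ) - Real.goldenRatio) := by
  have hτ := Algebra.self_mem_adjoin_singleton ℤ Real.goldenRatio
  have hsq := Real.goldenRatio_sq
  have hpos := Real.one_lt_goldenRatio
  rw [det_fibMatrix]
  push_cast
  rintro (⟨y, hy, h⟩ | ⟨y, hy, h⟩) <;> apply one_div_notMem_adjoin_goldenRatio hn <;> rw [h]
  -- Both denominators are units of ℤ[τ]: the inverse of τ - 1 is τ, and the inverse of -1 - τ is τ
  -- - 2.
  · have : y / (-1 + Real.goldenRatio) = y * Real.goldenRatio := by
      rw [div_eq_iff (by linarith)]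
      linear_combination -y * hsq
    rw [this]
    exact mul_mem hy hτ
  · have : y / (-1 - Real.goldenRatio) = y * (Real.goldenRatio - 2) := by
      rw [div_eq_iff (by linarith)]
      linear_combination y * hsq
    rw [this]
    exact mul_mem hy (sub_mem hτ (ofNat_mem _ 2))

theorem mainTheorem5 :
    (∀ (M : Matrix (Fin 2) (Fin 2) ℤ) (lam mu : ℝ) (v w : Fin 2 → ℝ),
      IsEigenFrame M lam mu v w →
        (|M 0 1| = 1 → latticeProj v = (Algebra.adjoin ℤ {lam} : Set ℝ)) ∧
        ∀ (L : ℝ) (Ω : Set ℝ), IsWindow Ω L →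
          L ∉ quotSet (latticeProj v) ((M.det : ℝ) + lam) ∪
              quotSet (latticeProj v) ((M.det : ℝ) - lam) →
          OnlyNonlocal (projectionTiling v w Ω) |lam|) ∧
    (∀ (v w : Fin 2 → ℝ), IsEigenFrame fibMatrix Real.goldenRatio Real.goldenConj v w →
      ∀ n : ℕ, 1 < n → ∀ Ω : Set ℝ, IsWindow Ω (1 / (n : ℝ)) →
        (1 / (n : ℝ)) ∉
          quotSet (Algebra.adjoin ℤ {Real.goldenRatio} : Set ℝ)
            ((fibMatrix.det : ℝ) + Real.goldenRatio) ∪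
          quotSet (Algebra.adjoin ℤ {Real.goldenRatio} : Set ℝ)
            ((fibMatrix.det : ℝ) - Real.goldenRatio) ∧
        AdmitsSubstitution (projectionTiling v w Ω) Real.goldenRatio ∧
        OnlyNonlocal (projectionTiling v w Ω) Real.goldenRatio) := by
  refine ⟨fun M lam mu v w h => ⟨h.latticeProj_eq_adjoin, fun L Ω => h.onlyNonlocal⟩,
    fun v w h n hn Ω hΩ => ⟨one_div_notMem_quotSet hn, ?_, ?_⟩⟩
  -- The lattice vector (0, 1) has `q`-value 1, so the length 1/n is a lattice length divided by n;
  -- the conjugate of τ supplies the negative m.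
  · have he : latticeProjY v ![0, 1] = 1 := by
      simp [latticeProjY, projY, latticeVec]
    refine (h.latticeFrame_of_pos Real.goldenRatio_pos).admitsSubstitution
      Real.goldenConj_neg (n := n) (by omega) (e := ![0, 1]) (by rw [he]; exact one_pos) ?_
    rwa [he]
  · have := h.onlyNonlocal hΩ
    rw [abs_of_pos Real.goldenRatio_pos, h.latticeProj_eq_adjoin (by simp [fibMatrix])] at this
    exact this (one_div_notMem_quotSet hn)
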